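/- Let $q$ be a prime power, and let $k,s,t$ and $0=u_0<1=u_1<u_2<\dots<u_s<u_{s+1}=k$ be integers with $2\le s\le t+1$. Let $U_i\subseteq\mathbb{F}_q^k$ be the span of the first $u_i$ standard basis vectors. There is a $k\times\frac{q^k-1}{q-1}$ matrix over $\mathbb{F}_q$ any two columns of which are linearly independent. Let $S$ be any such matrix, let $G_i$ be the submatrix of the columns of $S$ lying in $U_i$, and $S\setminus G_i$ the submatrix of the remaining columns. Let $C$ be the code generated by $$[\,G_1,\;S\setminus G_2,\;\dots,\;S\setminus G_s,\;\underbrace{S,\dots,S}_{t-s+1}\,]$$ (with the columns in any order). Notation: for a subspace $U$ of $\mathbb{F}_q^n$, $w(U)$ is the number of coordinates at which some element of $U$ is nonzero; for $1\le r\le \dim C$, $d_r(C)=\min\{w(U): U\le C,\ \dim U=r\}$; $A_j(C)$ is the number of codewords of Hamming weight $j$; $A^r_j(C)$ is the number of $r$-dimensional subspaces $U\le C$ with $w(U)=j$; $\delta_r(C)=n-d_r(C)-\sum_{i=1}^{\dim C-r}\left\lceil\frac{(q-1)d_r(C)}{q^i(q^r-1)}\right\rceil$. The code is an $r$-Griesmer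 code if $r$ is the least index in $\{1,\dots,\dim C\}$ with $\delta_r(C)=0$, an almost Griesmer code if $\delta_1(C)=1$, and distance-optimal if no linear code over $\mathbb{F}_q$ of the same length and dimension has larger minimum distance. $\binom{a}{b}_q=\prod_{i=0}^{b-1}\frac{q^a-q^i}{q^b-q^i}$ for $0\le b\le a$, and $\binom{a}{b}_q=0$ otherwise. Then $C$ has length $n=t\frac{q^k-1}{q-1}-\sum_{i=2}^s\frac{q^{u_i}-1}{q-1}+1$, dimension $k$ and minimum Hamming distance $d=tq^{k-1}-\sum_{i=2}^s q^{u_i-1}$, and: (a) $A_0(C)=1$, $A_d(C)=q^{k-1}-q^{k-u_2}$, $A_{d+1}(C)=q^k-q^{k-1}$; for $2\le l<s$, $A_j(C)=q^{k-u_l}-q^{k-u_{l+1}}$ with $j=d+\sum_{i=2}^l q^{u_i-1}$; $A_j(C)=q^{k-u_s}-1$ with $j=d+\sum_{i=2}^s q^{u_i-1}$; and $A_j(C)=0$ for all other $j$. (b) For $1\le r<u_2$, $$d_r(C)=t\frac{q^k-q^{k-r}}{q-1}-\sum_{i=2}^s\frac{q^{u_i}-q^{u_i-r}}{q-1},$$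 and for $u_2\le r\le k$, $$d_r(C)=t\frac{q^k-q^{k-r}}{q-1}-\sum_{i=2}^s\frac{q^{u_i}-1}{q-1}+\sum_{i=j_r+1}^s\frac{q^{u_i-r}-1}{q-1}+1,\qquad j_r=\max\{j: 2\le j\le s,\ u_j\le r\}.$$ (c) $C$ is a $u_2$-Griesmer code, an almost Griesmer code, and distance-optimal. (d) For $1\le r\le k$ and $1\le j\le n$, $$A_j^r(C)=\sum_{(v_0,\dots,v_{s+1})\in Z}\ \prod_{i=1}^{s+1}q^{(u_{i-1}-v_{i-1})(v_i-v_{i-1})}\binom{u_i-u_{i-1}}{v_i-v_{i-1}}_q,$$ where $Z$ is the set of integer tuples $(v_0,\dots,v_{s+1})$ with $v_0=0$, $v_{s+1}=k-r$, with $0\le v_i-v_{i-1}\le u_i-u_{i-1}$ and $\max\{0,u_i-r\}\le v_i\le\min\{u_i,k-r\}$ for $1\le i\le s$, and with $$j-t\frac{q^k-q^{k-r}}{q-1}+\sum_{i=2}^s\frac{q^{u_i}-1}{q-1}-1=\sum_{i=2}^s\frac{q^{v_i}-1}{q-1}-\frac{q^{v_1}-1}{q-1}.$$ -/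

import Mathlib

open Finset

noncomputable section

namespace SubcodeSupport

/-! ### Linear codes, generalized Hamming weights, Griesmer defect

A linear code of length `n` over `F` is a subspace of `Fin n → F`. -/

section Codes

variable {F : Type*} [Field F] {n : ℕ}

/-- The subcode support weight `w(U)`: the number of coordinates at which some word of `U`
does not vanish. -/
def suppWeight (U : Submodule F (Fin n → F)) : ℕ :=
  {i : Fin n | ∃ x ∈ U, x i ≠ 0}.ncard

/-- The minimum Hamming distance of a code. -/
def minDist [DecidableEq F] (C : Submodule F (Fin n → F)) : ℕ :=
  sInf {w | ∃ x ∈ C, ∃ y ∈ C, x ≠ y ∧ hammingDist x y = w}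

/-- `A_j(C)`: the number of codewords of Hamming weight `j`. -/
def weightCount [DecidableEq F] (C : Submodule F (Fin n → F)) (j : ℕ) : ℕ :=
  {x : Fin n → F | x ∈ C ∧ hammingNorm x = j}.ncard

/-- The `r`-generalized Hamming weight `d_r(C)`, for `1 ≤ r ≤ dim C`. -/
def genHammingWeight (C : Submodule F (Fin n → F)) (r : ℕ) : ℕ :=
  sInf {w | ∃ U : Submodule F (Fin n → F),
    U ≤ C ∧ Module.finrank F U = r ∧ suppWeight U = w}

/-- `A_j^r(C)`: the number of `r`-dimensional subcodes of subcode support weight `j`. -/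
def subcodeCount (C : Submodule F (Fin n → F)) (r j : ℕ) : ℕ :=
  {U : Submodule F (Fin n → F) |
    U ≤ C ∧ Module.finrank F U = r ∧ suppWeight U = j}.ncard

/-- The `r`-Griesmer defect
`δ_r(C) = n - d_r(C) - ∑_{i=1}^{k-r} ⌈(q-1) d_r(C) / (q^i (q^r - 1))⌉`, where `k = dim C`. -/
def griesmerDefect [Fintype F] (C : Submodule F (Fin n → F)) (r : ℕ) : ℤ :=
  (n : ℤ) - genHammingWeight C r -
    ∑ i ∈ Finset.Icc 1 (Module.finrank F C - r),
      ⌈(((Fintype.card F : ℚ) - 1) * genHammingWeight C r) /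
        ((Fintype.card F : ℚ) ^ i * ((Fintype.card F : ℚ) ^ r - 1))⌉

/-- `C` is an `r`-Griesmer code: `r` is the least `j` with `1 ≤ j ≤ dim C` and `δ_j(C) = 0`. -/
def IsRGriesmer [Fintype F] (C : Submodule F (Fin n → F)) (r : ℕ) : Prop :=
  IsLeast {j | 1 ≤ j ∧ j ≤ Module.finrank F C ∧ griesmerDefect C j = 0} r

/-- `C` is an almost Griesmer code: `δ_1(C) = 1`. -/
def IsAlmostGriesmer [Fintype F] (C : Submodule F (Fin n → F)) : Prop :=
  griesmerDefect C 1 = 1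

/-- `C` is distance-optimal: no code of the same length and dimension has a larger minimum
distance. -/
def IsDistanceOptimal [DecidableEq F] (C : Submodule F (Fin n → F)) : Prop :=
  ¬ ∃ C' : Submodule F (Fin n → F),
    Module.finrank F C' = Module.finrank F C ∧ minDist C < minDist C'

/-- The code generated by a matrix: the span of its rows. -/
def codeOf {k : ℕ} (G : Matrix (Fin k) (Fin n) F) : Submodule F (Fin n → F) :=
  Submodule.span F (Set.range G.row)

end Codes

/-! ### The construction -/

section Construction

variable {F : Type*} [Field F]

/-- A `k × N` matrix any two of whose columns are linearly independent. With
`N = (q^k - 1)/(q - 1)` (and `k ≥ 2`) this is a generator matrix of the simplex code. -/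
def PairwiseIndepCols {k N : ℕ} (S : Matrix (Fin k) (Fin N) F) : Prop :=
  ∀ i j : Fin N, i ≠ j → LinearIndependent F ![S.col i, S.col j]

variable (F) in
/-- The span of the first `m` standard basis vectors of `F^k`. -/
def coordSpan (k m : ℕ) : Submodule F (Fin k → F) :=
  Submodule.span F {x | ∃ a : Fin k, (a : ℕ) < m ∧ x = Pi.single a 1}

/-- Column indices of `[G₁, S ∖ G₂, …, S ∖ G_s, S, …, S]` with `t + 1 - s` final copies of `S`,
where `G_i` consists of the columns of `S` lying in the span of the first `u i` basis vectors. -/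
abbrev ColIdx {k N : ℕ} (S : Matrix (Fin k) (Fin N) F) (s t : ℕ) (u : ℕ → ℕ) : Type :=
  {c : Fin N // S.col c ∈ coordSpan F k (u 1)} ⊕
    (((i : {i : ℕ // i ∈ Finset.Icc 2 s}) × {c : Fin N // S.col c ∉ coordSpan F k (u i)}) ⊕
      (Fin (t + 1 - s) × Fin N))

/-- The column of `S` to which a column index refers. -/
def ColIdx.toCol {k N : ℕ} {S : Matrix (Fin k) (Fin N) F} {s t : ℕ} {u : ℕ → ℕ} :
    ColIdx S s t u → Fin N
  | Sum.inl c => c.1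
  | Sum.inr (Sum.inl p) => p.2.1
  | Sum.inr (Sum.inr p) => p.2

/-- The matrix `[G₁, S ∖ G₂, …, S ∖ G_s, S, …, S]`. -/
def blockMatrix {k N : ℕ} (S : Matrix (Fin k) (Fin N) F) (s t : ℕ) (u : ℕ → ℕ) :
    Matrix (Fin k) (ColIdx S s t u) F :=
  fun a c => S a (ColIdx.toCol c)

end Construction

/-! ### The counting formula -/

/-- The `q`-ary Gaussian binomial coefficient, zero if `r > k`. -/
def gaussBinom (q k r : ℕ) : ℚ :=
  if r ≤ k then
    ∏ i ∈ Finset.range r, ((q : ℚ) ^ k - (q : ℚ) ^ i) / ((q : ℚ) ^ r - (q : ℚ) ^ i)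
  else 0

/-- The entry `v_i` of a tuple `(v_0, …, v_{s+1})`, for `0 ≤ i ≤ s + 1`. -/
def entry {s : ℕ} (v : Fin (s + 2) → ℕ) (i : ℕ) : ℕ := v (Fin.ofNat (s + 2) i)

/-- The conditions that define the index set `Z(q, m)`, on a tuple `(v_0, v_1, …, v_{s+1})`
with `v_0 = 0` and `v_{s+1} = k - r`. -/
def IsAdmissible (q k r s : ℕ) (u : ℕ → ℕ) (m : ℚ) (v : Fin (s + 2) → ℕ) : Prop :=
  entry v 0 = 0 ∧ (entry v (s + 1) : ℤ) = (k : ℤ) - r ∧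
  (∀ i ∈ Finset.Icc 1 s,
    (0 : ℤ) ≤ (entry v i : ℤ) - entry v (i - 1) ∧
    (entry v i : ℤ) - entry v (i - 1) ≤ (u i : ℤ) - u (i - 1) ∧
    max 0 ((u i : ℤ) - r) ≤ (entry v i : ℤ) ∧
    (entry v i : ℤ) ≤ min (u i : ℤ) ((k : ℤ) - r)) ∧
  m = (∑ i ∈ Finset.Icc 2 s, ((q : ℚ) ^ entry v i - 1) / ((q : ℚ) - 1)) -
    ((q : ℚ) ^ entry v 1 - 1) / ((q : ℚ) - 1)

open Classical in
/-- The index set `Z(q, m)`; every entry of an admissible tuple is at most `k`, so bounding the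
entries by `k` loses nothing. -/
def tuples (q k r s : ℕ) (u : ℕ → ℕ) (m : ℚ) : Finset (Fin (s + 2) → ℕ) :=
  (Fintype.piFinset fun _ => Finset.range (k + 1)).filter (IsAdmissible q k r s u m)

/-- `∏_{i=1}^{s+1} q^{(u_{i-1}-v_{i-1})(v_i-v_{i-1})} [u_i-u_{i-1} choose v_i-v_{i-1}]_q`.
For admissible tuples none of the differences is negative. -/
def flagCount (q s : ℕ) (u : ℕ → ℕ) (v : Fin (s + 2) → ℕ) : ℚ :=
  ∏ i ∈ Finset.Icc 1 (s + 1),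
    (q : ℚ) ^ ((u (i - 1) - entry v (i - 1)) * (entry v i - entry v (i - 1))) *
      gaussBinom q (u i - u (i - 1)) (entry v i - entry v (i - 1))

end SubcodeSupport

end

/-! Write `[m]` for `(q^m - 1)/(q - 1)`, let `G` be the generator matrix and `φ` the map `a ↦ aG`. A
coordinate vanishes on `φ(A)` exactly when its column lies in `V = A^⊥`. The columns of `S`
represent every projective point once, so a subspace of dimension `m` contains `[m]` of them.
Counting the columns of `G` in `V` block by block gives `w(φ(A)) = t([k] - [dim V]) + 1 - [dim U_1 ∩
V] - ∑_{i≥2} ([u_i] - [dim U_i ∩ V])`. This is `SupportFormula`, proved in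
`supportFormula_blockMatrix`. Together with the length, it is all that the rest uses about the
construction.

Weights: for `A = ⟨a⟩` the hyperplane `a^⊥` contains `U_i` or meets it in codimension one. Hence the
weight of `φ(a)` depends only on the last flag member orthogonal to `a` (`hammingNorm_of_level`).
All these weights are positive, so `φ` is injective, and distinct levels have distinct weights.

Generalized weights: `d_r` minimizes `∑_{i≥2} [dim U_i ∩ V] - [dim U_1 ∩ V]` over `V` of codimension
`r`. Always `dim U_i ∩ V ≥ u_i - r`. Containing `U_1` is compatible with equality for all `i ≥ 2`
when `r < u_2`, and brings no net gain otherwise (`genHammingWeight_add`).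

Griesmer properties: up to a correction below one, `(q-1)d_r/(q^r-1)` is `t q^(k-r) - ∑ q^(u_i-r)`.
For `r ≤ u_2` the exponents `u_i - r` are distinct, so the ceilings are explicit (`ceil_div_pow`)
and the defect is 1 for `r < u_2` and 0 for `r = u_2`. As `q` divides `d`, replacing `d` by `d + 1`
raises the Griesmer sum by at least 2, beyond the length; `griesmer_bound` then gives optimality.

Subcodes: duality turns `r`-dimensional subcodes into subspaces `V` of dimension `k - r`, whose
weight is determined by the dimensions of the `U_i ∩ V`. The `V` with a prescribed profile are
counted by climbing the flag (`ncard_flag`). -/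

noncomputable section

namespace SubcodeSupport

/-! ### Counting along fibres -/

section Counting

/-- Double counting: the number of elements of a set as a sum over the fibres of a map. -/
theorem ncard_eq_sum_ncard_fiber {α β : Type*} [Finite α] (A : Set α) (f : α → β)
    (T : Finset β) (hf : ∀ a ∈ A, f a ∈ T) :
    A.ncard = ∑ b ∈ T, {a | a ∈ A ∧ f a = b}.ncard := by
  classical
  have := Fintype.ofFinite α
  have h := Finset.card_eq_sum_card_fiberwise (s := A.toFinset) (f := f) (t := T)
    (by intro a ha; simpa using hf a (by simpa using ha))
  rw [Set.ncard_eq_toFinset_card', h]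
  refine Finset.sum_congr rfl fun b _ => ?_
  rw [Set.ncard_eq_toFinset_card']
  congr 1
  ext a
  simp

theorem ncard_eq_mul_of_fiber {α β : Type*} [Finite α] [Finite β] (A : Set α) (B : Set β)
    (f : α → β) (hf : ∀ a ∈ A, f a ∈ B) (m : ℕ)
    (hm : ∀ b ∈ B, {a | a ∈ A ∧ f a = b}.ncard = m) :
    A.ncard = B.ncard * m := by
  classical
  have := Fintype.ofFinite β
  rw [ncard_eq_sum_ncard_fiber A f B.toFinset (by simpa using hf),
    Finset.sum_congr rfl (fun b hb => hm b (by simpa using hb)), Finset.sum_const,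
    Set.ncard_eq_toFinset_card', smul_eq_mul]

end Counting

/-! ### Counting subspaces relative to a flag -/

section Subspaces

variable {F : Type*} [Field F] [Fintype F]
variable {M N : Type*} [AddCommGroup M] [Module F M] [AddCommGroup N] [Module F N]

-- A linear section of `f` splits each tuple into the lift of its image and a tuple in the kernel;
-- only the image is constrained.
omit [Fintype F] in
theorem natCard_linearIndependent_comp [Finite M] (f : M →ₗ[F] N)
    (hf : Function.Surjective f) (m : ℕ) :
    Nat.card {x : Fin m → M // LinearIndependent F (f ∘ x)} =
      Nat.card {y : Fin m → N // LinearIndependent F y} * Nat.card (LinearMap.ker f) ^ m := by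
  obtain ⟨g, hg⟩ := f.exists_rightInverse_of_surjective (LinearMap.range_eq_top.mpr hf)
  have hg' : ∀ y, f (g y) = y := fun y => by
    simpa using congrArg (fun h : N →ₗ[F] N => h y) hg
  have e : {x : Fin m → M // LinearIndependent F (f ∘ x)} ≃
      {y : Fin m → N // LinearIndependent F y} × (Fin m → LinearMap.ker f) :=
    { toFun := fun x => (⟨f ∘ x.1, x.2⟩, fun i => ⟨x.1 i - g (f (x.1 i)), by simp [hg']⟩)
      invFun := fun p => ⟨fun i => g (p.1.1 i) + (p.2 i).1, by
        have : (f ∘ fun i => g (p.1.1 i) + (p.2 i).1) = p.1.1 := by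
          funext i
          have := (p.2 i).2
          rw [LinearMap.mem_ker] at this
          simp [hg', this]
        rw [this]
        exact p.1.2⟩
      left_inv := fun x => by ext i; simp
      right_inv := fun p => by
        have h : ∀ i, f (p.2 i).1 = 0 := fun i => (p.2 i).2
        ext i <;> simp [hg', h] }
  rw [Nat.card_congr e, Nat.card_prod, Nat.card_fun]
  simp

/-- Independence modulo `K` can be tested in `X/(X ⊓ K)`, of dimension `d`, because this quotient
embeds in `M/K`. Each image tuple then has `|X ⊓ K|^m` lifts. -/
theorem ncard_linearIndependent_mkQ [Finite M] (X K : Submodule F M) (m d : ℕ)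
    (hd : Module.finrank F X = Module.finrank F (X ⊓ K : Submodule F M) + d) (hm : m ≤ d) :
    {x : Fin m → M | (∀ i, x i ∈ X) ∧ LinearIndependent F (K.mkQ ∘ x)}.ncard =
      (∏ i : Fin m, (Fintype.card F ^ d - Fintype.card F ^ (i : ℕ))) *
        Fintype.card F ^ (Module.finrank F (X ⊓ K : Submodule F M) * m) := by
  let f : X →ₗ[F] (X ⧸ K.comap X.subtype) := (K.comap X.subtype).mkQ
  have e1 : {x : Fin m → M | (∀ i, x i ∈ X) ∧ LinearIndependent F (K.mkQ ∘ x)} ≃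
      {x : Fin m → X // LinearIndependent F (f ∘ x)} := by
    let h : (X ⧸ K.comap X.subtype) →ₗ[F] (M ⧸ K) :=
      (K.comap X.subtype).mapQ K X.subtype le_rfl
    have hinj : LinearMap.ker h = ⊥ := by
      simp only [h]
      rw [Submodule.mapQ, Submodule.ker_liftQ_eq_bot']
      rw [LinearMap.ker_comp, Submodule.ker_mkQ]
    have key : ∀ x : Fin m → X, LinearIndependent F (f ∘ x) ↔
        LinearIndependent F (K.mkQ ∘ fun i => (x i : M)) := by
      intro x
      rw [← LinearMap.linearIndependent_iff h hinj]
      rfl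
    exact
    { toFun := fun x => ⟨fun i => ⟨x.1 i, x.2.1 i⟩, (key _).2 x.2.2⟩
      invFun := fun x => ⟨fun i => x.1 i, fun i => (x.1 i).2, (key _).1 x.2⟩
      left_inv := fun x => rfl
      right_inv := fun x => rfl }
  have hfin : Finite (X ⧸ K.comap X.subtype) :=
    Finite.of_surjective _ (Submodule.mkQ_surjective _)
  have hker : LinearMap.ker f = K.comap X.subtype := Submodule.ker_mkQ _
  have hfr : Module.finrank F (K.comap X.subtype) =
      Module.finrank F (X ⊓ K : Submodule F M) := by
    rw [← Submodule.map_comap_subtype]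
    exact (Submodule.finrank_map_subtype_eq _ _).symm
  have hq : Module.finrank F (X ⧸ K.comap X.subtype) = d := by
    have := Submodule.finrank_quotient_add_finrank (K.comap X.subtype)
    omega
  rw [← Nat.card_coe_set_eq, Nat.card_congr e1,
    natCard_linearIndependent_comp f (Submodule.mkQ_surjective _) m,
    card_linearIndependent (by omega), hq, hker,
    Module.natCard_eq_pow_finrank (K := F) (V := K.comap X.subtype), hfr, pow_mul,
    Nat.card_eq_fintype_card]

/-- Double counting of the `m`-tuples `x` in `U'` that are independent modulo `U`. Each one
determines `V = W ⊔ span x`, and a given `V` comes from precisely the tuples inside `V` that are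
independent modulo `U`. -/
theorem ncard_extensions_mul [Finite M] {U U' W : Submodule F M} (hU : U ≤ U') (hW : W ≤ U)
    {m d : ℕ} (hd : Module.finrank F U' = Module.finrank F U + d) (hm : m ≤ d) :
    {V : Submodule F M | V ≤ U' ∧ V ⊓ U = W ∧
        Module.finrank F V = Module.finrank F W + m}.ncard *
      ((∏ i : Fin m, (Fintype.card F ^ m - Fintype.card F ^ (i : ℕ))) *
        Fintype.card F ^ (Module.finrank F W * m)) =
      (∏ i : Fin m, (Fintype.card F ^ d - Fintype.card F ^ (i : ℕ))) *
        Fintype.card F ^ (Module.finrank F U * m) := by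
  have hinf : U' ⊓ U = U := inf_eq_right.mpr hU
  rw [← hinf] at hd
  have key := ncard_linearIndependent_mkQ U' U m d hd hm
  rw [hinf] at key
  rw [← key]
  symm
  refine ncard_eq_mul_of_fiber _ _
    (fun x : Fin m → M => W ⊔ Submodule.span F (Set.range x)) ?_ _ ?_
  · rintro x ⟨hx, hli⟩
    have hdis := Submodule.range_ker_disjoint hli
    rw [Submodule.ker_mkQ] at hdis
    refine ⟨sup_le (hW.trans hU) (Submodule.span_le.mpr ?_), ?_, ?_⟩
    · rintro _ ⟨i, rfl⟩; exact hx i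
    · rw [sup_inf_assoc_of_le _ hW, hdis.eq_bot, sup_bot_eq]
    · have h1 := Submodule.finrank_sup_add_finrank_inf_eq W (Submodule.span F (Set.range x))
      rw [(hdis.symm.mono_left hW).eq_bot, finrank_bot,
        finrank_span_eq_card (LinearIndependent.of_comp _ hli), Fintype.card_fin] at h1
      simpa using h1
  · rintro V ⟨hVU, hVW, hV⟩
    have h2 := ncard_linearIndependent_mkQ V U m m (by rw [hVW]; exact hV) le_rfl
    rw [hVW] at h2
    rw [← h2]
    congr 1
    ext x
    simp only [Set.mem_ofPred_eq]
    constructor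
    · rintro ⟨⟨hx, hli⟩, rfl⟩
      exact ⟨fun i => Submodule.mem_sup_right (Submodule.subset_span ⟨i, rfl⟩), hli⟩
    · rintro ⟨hx, hli⟩
      refine ⟨⟨fun i => hVU (hx i), hli⟩, ?_⟩
      have hdis := Submodule.range_ker_disjoint hli
      rw [Submodule.ker_mkQ] at hdis
      refine Submodule.eq_of_le_of_finrank_eq
        (sup_le (hVW ▸ inf_le_left) (Submodule.span_le.mpr ?_)) ?_
      · rintro _ ⟨i, rfl⟩; exact hx i
      have h1 := Submodule.finrank_sup_add_finrank_inf_eq W (Submodule.span F (Set.range x))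
      rw [(hdis.symm.mono_left hW).eq_bot, finrank_bot,
        finrank_span_eq_card (LinearIndependent.of_comp _ hli), Fintype.card_fin] at h1
      rw [hV]
      simpa using h1

theorem cast_prod_pow_sub_pow {q : ℕ} (hq : 0 < q) {m d : ℕ} (hm : m ≤ d) :
    ((∏ i : Fin m, (q ^ d - q ^ (i : ℕ)) : ℕ) : ℚ) =
      ∏ i ∈ Finset.range m, ((q : ℚ) ^ d - (q : ℚ) ^ i) := by
  rw [Finset.prod_range, Nat.cast_prod]
  refine Finset.prod_congr rfl fun i _ => ?_
  rw [Nat.cast_sub (Nat.pow_le_pow_right hq (by omega))]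
  push_cast
  rfl

theorem ncard_extensions [Finite M] {U U' W : Submodule F M} (hU : U ≤ U') (hW : W ≤ U)
    {m d : ℕ} (hd : Module.finrank F U' = Module.finrank F U + d) (hm : m ≤ d) :
    ({V : Submodule F M | V ≤ U' ∧ V ⊓ U = W ∧
        Module.finrank F V = Module.finrank F W + m}.ncard : ℚ) =
      (Fintype.card F : ℚ) ^ ((Module.finrank F U - Module.finrank F W) * m) *
        gaussBinom (Fintype.card F) d m := by
  have key := congrArg (Nat.cast (R := ℚ)) (ncard_extensions_mul hU hW hd hm)
  have hq : 1 < Fintype.card F := Fintype.one_lt_card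
  have hq' : (1 : ℚ) < (Fintype.card F : ℚ) := by exact_mod_cast hq
  rw [Nat.cast_mul, Nat.cast_mul, Nat.cast_mul, cast_prod_pow_sub_pow (by omega) hm,
    cast_prod_pow_sub_pow (by omega) le_rfl] at key
  push_cast at key
  have hne : ∏ i ∈ Finset.range m, ((Fintype.card F : ℚ) ^ m - (Fintype.card F : ℚ) ^ i) ≠ 0 := by
    refine Finset.prod_ne_zero_iff.mpr fun i hi => ?_
    have := pow_lt_pow_right₀ hq' (Finset.mem_range.mp hi)
    linarith [this]
  have hle : Module.finrank F W ≤ Module.finrank F U := Submodule.finrank_mono hW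
  obtain ⟨c, hc⟩ := Nat.exists_eq_add_of_le hle
  rw [hc, add_mul, pow_add] at key
  rw [hc, Nat.add_sub_cancel_left, gaussBinom, if_pos hm, Finset.prod_div_distrib]
  have hz : (Fintype.card F : ℚ) ^ (Module.finrank F W * m) ≠ 0 := by positivity
  field_simp
  apply mul_left_cancel₀ hz
  linear_combination key

/-- The number of subspaces whose intersections with the members of a flag have prescribed
dimensions. -/
theorem ncard_flag [Finite M] (U : ℕ → Submodule F M) (hU : Monotone U) (hU0 : U 0 = ⊥)
    (v : ℕ → ℕ) (hv0 : v 0 = 0) (l : ℕ)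
    (hv : ∀ i < l, v i ≤ v (i + 1) ∧
      v (i + 1) - v i ≤ Module.finrank F (U (i + 1)) - Module.finrank F (U i)) :
    ({V : Submodule F M | V ≤ U l ∧
        ∀ i ≤ l, Module.finrank F (U i ⊓ V : Submodule F M) = v i}.ncard : ℚ) =
      ∏ i ∈ Finset.Icc 1 l,
        (Fintype.card F : ℚ) ^ ((Module.finrank F (U (i - 1)) - v (i - 1)) * (v i - v (i - 1))) *
          gaussBinom (Fintype.card F) (Module.finrank F (U i) - Module.finrank F (U (i - 1)))
            (v i - v (i - 1)) := by
  induction l with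
  | zero =>
    have : {V : Submodule F M | V ≤ U 0 ∧
        ∀ i ≤ 0, Module.finrank F (U i ⊓ V : Submodule F M) = v i} = {⊥} := by
      ext V
      simp [hU0, hv0]
    rw [this]
    simp
  | succ l ih =>
    rw [Finset.prod_Icc_succ_top (by omega), ← ih fun i hi => hv i (by omega)]
    obtain ⟨h1, h2⟩ := hv l (by omega)
    have hmono : Module.finrank F (U l) ≤ Module.finrank F (U (l + 1)) :=
      Submodule.finrank_mono (hU (Nat.le_add_right l 1))
    -- Fibre over `V ⊓ U l`, which has the same profile up to `l`; each fibre is a set of extensions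
    -- of one `W`.
    have key := ncard_eq_mul_of_fiber
      {V : Submodule F M | V ≤ U (l + 1) ∧
        ∀ i ≤ l + 1, Module.finrank F (U i ⊓ V : Submodule F M) = v i}
      {V : Submodule F M | V ≤ U l ∧
        ∀ i ≤ l, Module.finrank F (U i ⊓ V : Submodule F M) = v i}
      (fun V => V ⊓ U l) (by
        rintro V ⟨hV, hVi⟩
        refine ⟨inf_le_right, fun i hi => ?_⟩
        rw [← hVi i (by omega), inf_comm V, ← inf_assoc, inf_eq_left.mpr (hU hi)])
    obtain ⟨m, hm⟩ := Nat.exists_eq_add_of_le h1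
    have hext : ∀ W ∈ {V : Submodule F M | V ≤ U l ∧
        ∀ i ≤ l, Module.finrank F (U i ⊓ V : Submodule F M) = v i},
        {V | V ∈ {V : Submodule F M | V ≤ U (l + 1) ∧
          ∀ i ≤ l + 1, Module.finrank F (U i ⊓ V : Submodule F M) = v i} ∧ V ⊓ U l = W} =
        {V : Submodule F M | V ≤ U (l + 1) ∧ V ⊓ U l = W ∧
          Module.finrank F V = Module.finrank F W + m} ∧ Module.finrank F W = v l := by
      rintro W ⟨hW, hWi⟩
      have hWl : Module.finrank F W = v l := by
        rw [← hWi l le_rfl, inf_eq_right.mpr hW]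
      refine ⟨?_, hWl⟩
      ext V
      simp only [Set.mem_ofPred_eq]
      constructor
      · rintro ⟨⟨hV, hVi⟩, hVW⟩
        refine ⟨hV, hVW, ?_⟩
        have := hVi (l + 1) le_rfl
        rw [inf_eq_right.mpr hV] at this
        omega
      · rintro ⟨hV, hVW, hf⟩
        refine ⟨⟨hV, fun i hi => ?_⟩, hVW⟩
        rcases Nat.lt_or_ge l i with h | h
        · have : i = l + 1 := by omega
          subst this
          rw [inf_eq_right.mpr hV]
          omega
        · rw [← hWi i h, ← hVW, inf_comm V, ← inf_assoc, inf_eq_left.mpr (hU h)]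
    have hcount : ∀ W ∈ {V : Submodule F M | V ≤ U l ∧
        ∀ i ≤ l, Module.finrank F (U i ⊓ V : Submodule F M) = v i},
        (({V | V ∈ {V : Submodule F M | V ≤ U (l + 1) ∧
          ∀ i ≤ l + 1, Module.finrank F (U i ⊓ V : Submodule F M) = v i} ∧ V ⊓ U l = W}.ncard :
            ℕ) : ℚ) =
        (Fintype.card F : ℚ) ^ ((Module.finrank F (U l) - v l) * m) *
          gaussBinom (Fintype.card F) (Module.finrank F (U (l + 1)) - Module.finrank F (U l))
            m := by
      intro W hW
      obtain ⟨h3, h4⟩ := hext W hW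
      rw [h3, ncard_extensions (hU (Nat.le_add_right l 1)) hW.1
        (d := Module.finrank F (U (l + 1)) - Module.finrank F (U l)) (by omega) (by omega), h4]
    have hm' : v (l + 1) - v l = m := by omega
    rw [Nat.add_sub_cancel, hm']
    -- The fibre size is known only as a rational expression. Its natural-number value is read off
    -- one fixed `W`; if there is no `W`, both sides vanish.
    rcases Set.eq_empty_or_nonempty {V : Submodule F M | V ≤ U l ∧
        ∀ i ≤ l, Module.finrank F (U i ⊓ V : Submodule F M) = v i} with he | ⟨W, hW⟩
    · have h := key 0 (by rw [he]; simp)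
      rw [h, he]
      simp
    · rw [← hcount W hW, ← Nat.cast_mul]
      congr 1
      refine key _ fun W' hW' => ?_
      exact_mod_cast (hcount W' hW').trans (hcount W hW).symm

end Subspaces

/-! ### Coordinate subspaces -/

section Coordinates

variable {F : Type*} [Field F] {k : ℕ}

variable (F) in
/-- The vectors supported on a set `T` of coordinates. -/
def coordSub (T : Finset (Fin k)) : Submodule F (Fin k → F) :=
  ⨅ a ∈ (↑T : Set (Fin k))ᶜ, LinearMap.ker (LinearMap.proj a : (Fin k → F) →ₗ[F] F)

theorem mem_coordSub {T : Finset (Fin k)} {x : Fin k → F} :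
    x ∈ coordSub F T ↔ ∀ a ∉ T, x a = 0 := by
  simp [coordSub, Submodule.mem_iInf]

theorem finrank_coordSub (T : Finset (Fin k)) : Module.finrank F (coordSub F T) = #T := by
  classical
  have e := LinearMap.iInfKerProjEquiv F (fun _ : Fin k => F) (I := (↑T : Set (Fin k)))
    (J := (↑T : Set (Fin k))ᶜ) disjoint_compl_right (by simp)
  rw [coordSub, LinearEquiv.finrank_eq e, Module.finrank_fintype_fun_eq_card]
  simp

theorem coordSub_inf (T T' : Finset (Fin k)) :
    coordSub F T ⊓ coordSub F T' = coordSub F (T ∩ T') := by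
  ext x
  simp only [Submodule.mem_inf, mem_coordSub, Finset.mem_inter, not_and_or]
  exact ⟨fun h a ha => ha.elim (h.1 a) (h.2 a), fun h => ⟨fun a ha => h a (.inl ha),
    fun a ha => h a (.inr ha)⟩⟩

theorem coordSpan_eq_coordSub (m : ℕ) :
    coordSpan F k m = coordSub F {a : Fin k | (a : ℕ) < m} := by
  apply le_antisymm
  · refine Submodule.span_le.mpr ?_
    rintro _ ⟨a, ha, rfl⟩
    rw [SetLike.mem_coe, mem_coordSub]
    intro b hb
    rw [Pi.single_apply, if_neg]
    rintro rfl
    simp [ha] at hb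
  · intro x hx
    rw [mem_coordSub] at hx
    rw [pi_eq_sum_univ x]
    refine Submodule.sum_mem _ fun a _ => ?_
    by_cases ha : (a : ℕ) < m
    · refine Submodule.smul_mem _ _ (Submodule.subset_span ⟨a, ha, ?_⟩)
      ext b
      simp [Pi.single_apply, eq_comm]
    · rw [hx a (by simpa using ha), zero_smul]
      exact Submodule.zero_mem _

theorem mem_coordSpan {m : ℕ} {x : Fin k → F} :
    x ∈ coordSpan F k m ↔ ∀ a : Fin k, m ≤ a → x a = 0 := by
  simp [coordSpan_eq_coordSub, mem_coordSub]

theorem finrank_coordSpan {m : ℕ} (hm : m ≤ k) : Module.finrank F (coordSpan F k m) = m := by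
  rw [coordSpan_eq_coordSub, finrank_coordSub]
  simp [Fin.card_filter_val_lt, hm]

theorem coordSpan_mono {m m' : ℕ} (h : m ≤ m') : coordSpan F k m ≤ coordSpan F k m' :=
  fun _ hx => mem_coordSpan.mpr fun a ha => mem_coordSpan.mp hx a (h.trans ha)

theorem coordSpan_zero : coordSpan F k 0 = ⊥ := by
  rw [eq_bot_iff]
  intro _ hx
  ext a
  exact mem_coordSpan.mp hx a (Nat.zero_le _)

theorem coordSpan_self : coordSpan F k k = ⊤ := by
  rw [eq_top_iff]
  exact fun _ _ => mem_coordSpan.mpr fun a ha => absurd a.2 (by omega)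

end Coordinates

/-! ### Duality for the dot product -/

section Perp

variable {F : Type*} [Field F] {k : ℕ}

/-- The dual of a subspace of `F^k` with respect to the dot product. -/
def dotPerp (A : Submodule F (Fin k → F)) : Submodule F (Fin k → F) :=
  LinearMap.BilinForm.orthogonal (dotProductBilin F F) A

theorem mem_dotPerp {A : Submodule F (Fin k → F)} {x : Fin k → F} :
    x ∈ dotPerp A ↔ ∀ a ∈ A, a ⬝ᵥ x = 0 := Iff.rfl

theorem dotProductBilin_isRefl :
    LinearMap.BilinForm.IsRefl (dotProductBilin F F : LinearMap.BilinForm F (Fin k → F)) :=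
  fun x y h => by
    rw [dotProductBilin_apply_apply] at h ⊢
    rwa [dotProduct_comm]

theorem dotProductBilin_nondegenerate :
    LinearMap.BilinForm.Nondegenerate (dotProductBilin F F : LinearMap.BilinForm F (Fin k → F)) := by
  refine (LinearMap.IsRefl.nondegenerate_iff_separatingLeft
    (B := (dotProductBilin F F : LinearMap.BilinForm F (Fin k → F)))
    dotProductBilin_isRefl).mpr ?_
  intro x hx
  exact dotProduct_eq_zero x hx

theorem finrank_dotPerp (A : Submodule F (Fin k → F)) :
    Module.finrank F (dotPerp A) = k - Module.finrank F A := by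
  rw [dotPerp, LinearMap.BilinForm.finrank_orthogonal dotProductBilin_nondegenerate,
    Module.finrank_fintype_fun_eq_card, Fintype.card_fin]

theorem dotPerp_dotPerp (A : Submodule F (Fin k → F)) : dotPerp (dotPerp A) = A :=
  LinearMap.BilinForm.orthogonal_orthogonal dotProductBilin_nondegenerate
    dotProductBilin_isRefl A

theorem finrank_le_of_ambient (A : Submodule F (Fin k → F)) : Module.finrank F A ≤ k := by
  simpa using Submodule.finrank_le A

end Perp

/-! ### Columns as projective points -/

section Points

variable {F : Type*} [Field F] [Fintype F]

/-- Columns of a matrix that represents all points of the projective space. -/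
theorem card_col_mem [DecidableEq F] {k : ℕ} (hk : 2 ≤ k)
    {S : Matrix (Fin k) (Fin ((Fintype.card F ^ k - 1) / (Fintype.card F - 1))) F}
    (hS : PairwiseIndepCols S) (W : Submodule F (Fin k → F)) :
    {c | S.col c ∈ W}.ncard =
      ∑ i ∈ Finset.range (Module.finrank F W), Fintype.card F ^ i := by
  classical
  have hq : 1 < Fintype.card F := Fintype.one_lt_card
  have hN := Nat.geomSum_eq hq k
  have hmul : ∀ m, (Fintype.card F - 1) * ∑ i ∈ Finset.range m, Fintype.card F ^ i + 1 =
      Fintype.card F ^ m := by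
    intro m
    obtain ⟨p, hp⟩ := Nat.exists_eq_add_of_lt hq
    rw [hp, show 1 + p + 1 - 1 = p + 1 by omega, mul_comm]
    have h2 := geom_sum_mul_add (p + 1) m
    convert h2 using 2 <;> ring_nf
  -- Pairwise independence forces nonzero columns only if a second column exists; this is where `k ≥
  -- 2` enters.
  have hne : ∀ c, S.col c ≠ 0 := by
    intro c
    have h1 : 1 < (Fintype.card F ^ k - 1) / (Fintype.card F - 1) := by
      rw [← hN]
      calc 1 < ∑ i ∈ Finset.range 2, Fintype.card F ^ i := by
            simp [Finset.sum_range_succ]; omega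
        _ ≤ _ := Finset.sum_le_sum_of_subset (Finset.range_mono hk)
    have : Nontrivial (Fin ((Fintype.card F ^ k - 1) / (Fintype.card F - 1))) :=
      Fin.nontrivial_iff_two_le.mpr h1
    obtain ⟨c', hc'⟩ := exists_ne c
    exact (hS c c' hc'.symm).ne_zero 0
  -- Scaling columns by units is injective into the nonzero vectors, and `(q - 1)N = q^k - 1` makes
  -- it bijective. Restricted to `W`, it counts the columns in `W`.
  let f : Fˣ × Fin ((Fintype.card F ^ k - 1) / (Fintype.card F - 1)) → {x : Fin k → F // x ≠ 0} :=
    fun p => ⟨(p.1 : F) • S.col p.2, smul_ne_zero p.1.ne_zero (hne _)⟩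
  have hinj : Function.Injective f := by
    rintro ⟨α, c⟩ ⟨β, c'⟩ h
    have h' : (α : F) • S.col c = (β : F) • S.col c' := congrArg Subtype.val h
    by_cases hc : c = c'
    · subst hc
      have := smul_left_injective F (hne c) h'
      rw [Units.ext this]
    · exfalso
      have hli := LinearIndependent.pair_iff.mp (hS c c' hc) α (-β) (by
        rw [neg_smul, h', add_neg_cancel])
      exact α.ne_zero hli.1
  have hbij : Function.Bijective f := by
    rw [Fintype.bijective_iff_injective_and_card]
    refine ⟨hinj, ?_⟩
    rw [Fintype.card_prod, Fintype.card_units, Fintype.card_fin, ← hN]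
    have h1 := hmul k
    have h2 : Fintype.card {x : Fin k → F // x ≠ 0} = Fintype.card F ^ k - 1 := by
      simp
    omega
  have e : {p : Fˣ × Fin ((Fintype.card F ^ k - 1) / (Fintype.card F - 1)) // S.col p.2 ∈ W} ≃
      {x : W // x ≠ 0} := by
    refine Equiv.ofBijective
      (fun p => ⟨⟨(f p.1).1, W.smul_mem _ p.2⟩, fun h => (f p.1).2 (congrArg Subtype.val h)⟩) ?_
    constructor
    · intro p p' h
      exact Subtype.ext (hinj (Subtype.ext (congrArg (fun x => x.1.1) h)))
    · rintro ⟨⟨x, hx⟩, hx0⟩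
      obtain ⟨p, hp⟩ := hbij.2 ⟨x, fun h => hx0 (Subtype.ext h)⟩
      have hp' : (p.1 : F) • S.col p.2 = x := congrArg Subtype.val hp
      refine ⟨⟨p, ?_⟩, Subtype.ext (Subtype.ext hp')⟩
      rw [← hp'] at hx
      exact (Submodule.smul_mem_iff W p.1.ne_zero).mp hx
  have e2 : {p : Fˣ × Fin ((Fintype.card F ^ k - 1) / (Fintype.card F - 1)) // S.col p.2 ∈ W} ≃
      Fˣ × {c // S.col c ∈ W} :=
    { toFun := fun p => (p.1.1, ⟨p.1.2, p.2⟩)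
      invFun := fun p => ⟨(p.1, p.2.1), p.2.2⟩
      left_inv := fun p => rfl
      right_inv := fun p => rfl }
  have hcard := Nat.card_congr (e2.symm.trans e)
  rw [Nat.card_prod, Nat.card_eq_fintype_card, Fintype.card_units,
    Nat.card_eq_fintype_card (α := {x : W // x ≠ 0}), Fintype.card_subtype_compl,
    Fintype.card_subtype_eq, Module.card_eq_pow_finrank (K := F) (V := W)] at hcard
  have hc2 : {c | S.col c ∈ W}.ncard = Nat.card {c // S.col c ∈ W} := rfl
  have h1 := hmul (Module.finrank F W)
  rw [hc2]
  refine Nat.eq_of_mul_eq_mul_left (show 0 < Fintype.card F - 1 by omega) ?_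
  omega

/-- One representative of each projective point: distinct points have independent representatives.
-/
theorem exists_pairwiseIndepCols [DecidableEq F] (k : ℕ) :
    ∃ S : Matrix (Fin k) (Fin ((Fintype.card F ^ k - 1) / (Fintype.card F - 1))) F,
      PairwiseIndepCols S := by
  classical
  have hc : Nat.card (Projectivization F (Fin k → F)) =
      (Fintype.card F ^ k - 1) / (Fintype.card F - 1) := by
    rw [Projectivization.card'' F (Fin k → F), Nat.card_fun]
    simp
  have e : Fin ((Fintype.card F ^ k - 1) / (Fintype.card F - 1)) ≃
      Projectivization F (Fin k → F) := (Finite.equivFinOfCardEq hc).symm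
  refine ⟨fun a c => (e c).rep a, fun i j hij => ?_⟩
  have h := (Projectivization.independent_pair_iff_ne (e i) (e j)).mpr (e.injective.ne hij)
  rw [Projectivization.independent_iff] at h
  have he : ![Matrix.col (fun a c => (e c).rep a) i, Matrix.col (fun a c => (e c).rep a) j] =
      Projectivization.rep ∘ ![e i, e j] := by
    ext x a
    fin_cases x <;> rfl
  rw [he]
  exact h

end Points

/-! ### Support weight through columns -/

section Support

variable {F : Type*} [Field F] {n k : ℕ}

/-- Coordinate `i` of `aG` is the dot product of `a` with column `i`, so it vanishes on the image of
`A` exactly when that column lies in the dual. -/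
theorem suppWeight_map_vecMulLinear (G : Matrix (Fin k) (Fin n) F)
    (A : Submodule F (Fin k → F)) :
    suppWeight (A.map G.vecMulLinear) + {i | G.col i ∈ dotPerp A}.ncard = n := by
  have h : {i : Fin n | ∃ x ∈ A.map G.vecMulLinear, x i ≠ 0} = {i | G.col i ∈ dotPerp A}ᶜ := by
    ext i
    simp only [Set.mem_ofPred_eq, Set.mem_compl_iff, mem_dotPerp, Submodule.mem_map, not_forall]
    constructor
    · rintro ⟨_, ⟨a, ha, rfl⟩, hx⟩
      exact ⟨a, ha, hx⟩
    · rintro ⟨a, ha, hx⟩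
      exact ⟨_, ⟨a, ha, rfl⟩, hx⟩
  rw [suppWeight, h, add_comm, Set.ncard_add_ncard_compl, Nat.card_eq_fintype_card,
    Fintype.card_fin]

theorem suppWeight_span_singleton [DecidableEq F] (x : Fin n → F) :
    suppWeight (Submodule.span F {x}) = hammingNorm x := by
  rw [suppWeight, hammingNorm, ← Set.ncard_coe_finset]
  congr 1
  ext i
  simp only [Set.mem_ofPred_eq, Finset.coe_filter, Finset.mem_univ, true_and]
  constructor
  · rintro ⟨y, hy, hi⟩ h0
    obtain ⟨c, rfl⟩ := Submodule.mem_span_singleton.mp hy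
    exact hi (by simp [h0])
  · exact fun h => ⟨x, Submodule.mem_span_singleton_self x, h⟩

theorem codeOf_eq_range (G : Matrix (Fin k) (Fin n) F) :
    codeOf G = LinearMap.range G.vecMulLinear := (range_vecMulLinear G).symm

end Support

/-! ### Columns of the block matrix in a subspace -/

section Block

variable {F : Type*} [Field F]

/-- Each block `S ∖ G_i` contributes the columns in `V` minus those in `U_i ∩ V`. The `s - 1` such
blocks and the `t + 1 - s` copies of `S` make `t` full counts, and `G_1` adds its own. -/
theorem ncard_colIdx {k N : ℕ} (S : Matrix (Fin k) (Fin N) F) (g : ℕ → ℕ)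
    (hS : ∀ W : Submodule F (Fin k → F), {c | S.col c ∈ W}.ncard = g (Module.finrank F W))
    {s t : ℕ} (hs : 2 ≤ s) (hst : s ≤ t + 1) (u : ℕ → ℕ) (V : Submodule F (Fin k → F)) :
    {x : ColIdx S s t u | S.col x.toCol ∈ V}.ncard +
        ∑ i ∈ Finset.Icc 2 s, g (Module.finrank F (coordSpan F k (u i) ⊓ V : Submodule F _)) =
      t * g (Module.finrank F V) +
        g (Module.finrank F (coordSpan F k (u 1) ⊓ V : Submodule F _)) := by
  classical
  have hP : ∀ W : Submodule F (Fin k → F),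
      Fintype.card {c // S.col c ∈ W} = g (Module.finrank F W) := by
    intro W
    rw [← hS W, ← Nat.card_eq_fintype_card]
    rfl
  have e : {x : ColIdx S s t u // S.col x.toCol ∈ V} ≃
      {c // S.col c ∈ coordSpan F k (u 1) ⊓ V} ⊕
        (((i : {i : ℕ // i ∈ Finset.Icc 2 s}) ×
          {c // S.col c ∈ V ∧ S.col c ∉ coordSpan F k (u i)}) ⊕
        (Fin (t + 1 - s) × {c // S.col c ∈ V})) :=
    { toFun := fun x => match x with
        | ⟨Sum.inl c, h⟩ => Sum.inl ⟨c.1, c.2, h⟩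
        | ⟨Sum.inr (Sum.inl p), h⟩ => Sum.inr (Sum.inl ⟨p.1, p.2.1, h, p.2.2⟩)
        | ⟨Sum.inr (Sum.inr p), h⟩ => Sum.inr (Sum.inr ⟨p.1, p.2, h⟩)
      invFun := fun x => match x with
        | Sum.inl c => ⟨Sum.inl ⟨c.1, c.2.1⟩, c.2.2⟩
        | Sum.inr (Sum.inl p) => ⟨Sum.inr (Sum.inl ⟨p.1, p.2.1, p.2.2.2⟩), p.2.2.1⟩
        | Sum.inr (Sum.inr p) => ⟨Sum.inr (Sum.inr (p.1, p.2.1)), p.2.2⟩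
      left_inv := by rintro ⟨c | p | p, h⟩ <;> rfl
      right_inv := by rintro (c | p | p) <;> rfl }
  have hsplit : ∀ i, Fintype.card {c // S.col c ∈ V ∧ S.col c ∉ coordSpan F k (u i)} +
      g (Module.finrank F (coordSpan F k (u i) ⊓ V : Submodule F _)) =
        g (Module.finrank F V) := by
    intro i
    rw [← hP, ← hP, Fintype.card_subtype, Fintype.card_subtype, Fintype.card_subtype, add_comm,
      ← Finset.card_filter_add_card_filter_not (s := univ.filter fun c => S.col c ∈ V)
        (fun c => S.col c ∈ coordSpan F k (u i)), Finset.filter_filter, Finset.filter_filter]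
    simp only [Submodule.mem_inf, and_comm]
  have h1 : {x : ColIdx S s t u | S.col x.toCol ∈ V}.ncard =
      Nat.card {x : ColIdx S s t u // S.col x.toCol ∈ V} := rfl
  rw [h1, Nat.card_congr e, Nat.card_eq_fintype_card, Fintype.card_sum, Fintype.card_sum,
    Fintype.card_prod, Fintype.card_fin, Fintype.card_sigma, hP, hP,
    Finset.sum_coe_sort (Finset.Icc 2 s)
      (fun i => Fintype.card {c // S.col c ∈ V ∧ S.col c ∉ coordSpan F k (u i)})]
  have h2 : ∑ i ∈ Finset.Icc 2 s,
        Fintype.card {c // S.col c ∈ V ∧ S.col c ∉ coordSpan F k (u i)} +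
      ∑ i ∈ Finset.Icc 2 s, g (Module.finrank F (coordSpan F k (u i) ⊓ V : Submodule F _)) =
        (s - 1) * g (Module.finrank F V) := by
    rw [← Finset.sum_add_distrib, Finset.sum_congr rfl fun i _ => hsplit i, Finset.sum_const,
      Nat.card_Icc, smul_eq_mul]
    congr 1
  have h3 : (s - 1) * g (Module.finrank F V) + (t + 1 - s) * g (Module.finrank F V) =
      t * g (Module.finrank F V) := by
    rw [← add_mul]
    congr 1
    omega
  omega

end Block

/-! ### The support formula -/

section Formula

variable {F : Type*} [Field F]

/-- The number of points of the projective space of an `m`-dimensional space. -/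
def numPoints (q m : ℕ) : ℕ := ∑ i ∈ Finset.range m, q ^ i

theorem numPoints_mono (q : ℕ) : Monotone (numPoints q) := fun _ _ h =>
  Finset.sum_le_sum_of_subset (Finset.range_mono h)

theorem numPoints_succ (q m : ℕ) : numPoints q (m + 1) = numPoints q m + q ^ m :=
  Finset.sum_range_succ _ _

theorem numPoints_zero (q : ℕ) : numPoints q 0 = 0 := rfl

theorem numPoints_one (q : ℕ) : numPoints q 1 = 1 := by simp [numPoints]

theorem cast_numPoints {q : ℕ} (hq : 1 < q) (m : ℕ) :
    (numPoints q m : ℚ) = ((q : ℚ) ^ m - 1) / ((q : ℚ) - 1) := by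
  have : (q : ℚ) ≠ 1 := by exact_mod_cast hq.ne'
  rw [numPoints, Nat.cast_sum, ← geom_sum_eq this]
  simp

/-- The support weight of the image of every subspace, in terms of the dimensions of the
intersections of its dual with the coordinate flag. -/
def SupportFormula (q k s t : ℕ) (u : ℕ → ℕ) {n : ℕ} (φ : (Fin k → F) →ₗ[F] (Fin n → F)) : Prop :=
  ∀ A : Submodule F (Fin k → F),
    suppWeight (A.map φ) + t * numPoints q (k - Module.finrank F A) +
        numPoints q (Module.finrank F (coordSpan F k (u 1) ⊓ dotPerp A : Submodule F _)) +
        ∑ i ∈ Finset.Icc 2 s, numPoints q (u i) =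
      t * numPoints q k + 1 + ∑ i ∈ Finset.Icc 2 s,
        numPoints q (Module.finrank F (coordSpan F k (u i) ⊓ dotPerp A : Submodule F _))

/-- The dimensions of a coordinate flag. -/
structure IsFlagType (k s : ℕ) (u : ℕ → ℕ) : Prop where
  two_le : 2 ≤ s
  zero : u 0 = 0
  one : u 1 = 1
  last : u (s + 1) = k
  lt_succ : ∀ i ≤ s, u i < u (i + 1)

namespace IsFlagType

variable {k s : ℕ} {u : ℕ → ℕ}

theorem lt (h : IsFlagType k s u) {i j : ℕ} (hij : i < j) (hj : j ≤ s + 1) : u i < u j := by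
  induction j, hij using Nat.le_induction with
  | base => exact h.lt_succ i (by omega)
  | succ j hj' ih => exact (ih (by omega)).trans (h.lt_succ j (by omega))

theorem le (h : IsFlagType k s u) {i j : ℕ} (hij : i ≤ j) (hj : j ≤ s + 1) : u i ≤ u j := by
  rcases hij.eq_or_lt with rfl | h'
  · exact le_rfl
  · exact (h.lt h' hj).le

theorem le_last (h : IsFlagType k s u) {i : ℕ} (hi : i ≤ s + 1) : u i ≤ k :=
  h.last ▸ h.le hi le_rfl

theorem lt_last (h : IsFlagType k s u) {i : ℕ} (hi : i ≤ s) : u i < k :=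
  h.last ▸ h.lt (by omega) le_rfl

theorem two_le_of (h : IsFlagType k s u) {i : ℕ} (h2 : 2 ≤ i) (hi : i ≤ s + 1) : 2 ≤ u i := by
  have := h.lt (show 1 < i by omega) hi
  rw [h.one] at this
  exact this

theorem three_le (h : IsFlagType k s u) : 3 ≤ k := by
  have h1 := h.lt_last (i := 2) h.two_le
  have h2 := h.two_le_of (i := 2) le_rfl (by have := h.two_le; omega)
  omega

end IsFlagType

/-- The column count for `V = ⊤` is the length; the count for `V = dotPerp A`, subtracted from the
length, is the support weight. -/
theorem supportFormula_blockMatrix [Fintype F] [DecidableEq F] {k s t n : ℕ} {u : ℕ → ℕ}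
    (hu : IsFlagType k s u) (hst : s ≤ t + 1)
    {S : Matrix (Fin k) (Fin ((Fintype.card F ^ k - 1) / (Fintype.card F - 1))) F}
    (hS : PairwiseIndepCols S) (e : Fin n ≃ ColIdx S s t u) :
    n + ∑ i ∈ Finset.Icc 2 s, numPoints (Fintype.card F) (u i) =
        t * numPoints (Fintype.card F) k + 1 ∧
      SupportFormula (Fintype.card F) k s t u
        ((blockMatrix S s t u).submatrix id e).vecMulLinear := by
  have hk := hu.three_le
  have hcol := ncard_colIdx S (numPoints (Fintype.card F)) (card_col_mem (by omega) hS)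
    hu.two_le hst u
  have hcount : ∀ V : Submodule F (Fin k → F),
      {i | ((blockMatrix S s t u).submatrix id e).col i ∈ V}.ncard =
        {x : ColIdx S s t u | S.col x.toCol ∈ V}.ncard := by
    intro V
    exact Nat.card_congr (e.subtypeEquiv fun i => Iff.rfl)
  have hdim : ∀ i ∈ Finset.Icc 2 s, Module.finrank F (coordSpan F k (u i)) = u i := by
    intro i hi
    rw [Finset.mem_Icc] at hi
    exact finrank_coordSpan (hu.le_last (by omega))
  have hlen : n + ∑ i ∈ Finset.Icc 2 s, numPoints (Fintype.card F) (u i) =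
      t * numPoints (Fintype.card F) k + 1 := by
    have h := hcol ⊤
    rw [← hcount ⊤] at h
    have hinf : ∀ m, Module.finrank F (coordSpan F k m ⊓ ⊤ : Submodule F (Fin k → F)) =
        Module.finrank F (coordSpan F k m) := fun m => by rw [inf_top_eq]
    simp only [hinf, Submodule.mem_top, finrank_top, Module.finrank_fintype_fun_eq_card,
      Fintype.card_fin] at h
    rw [finrank_coordSpan (hu.le_last (by omega)), hu.one, numPoints_one,
      Finset.sum_congr rfl fun i hi => by rw [hdim i hi]] at h
    rw [← h]
    congr 1
    have : {i : Fin n | True} = Set.univ := rfl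
    rw [this, Set.ncard_univ, Nat.card_eq_fintype_card, Fintype.card_fin]
  refine ⟨hlen, fun A => ?_⟩
  have h1 := suppWeight_map_vecMulLinear ((blockMatrix S s t u).submatrix id e) A
  have h2 := hcol (dotPerp A)
  rw [← hcount, finrank_dotPerp] at h2
  omega

end Formula

/-! ### The coordinate flag against dual subspaces -/

section Flag

variable {F : Type*} [Field F] {k s : ℕ} {u : ℕ → ℕ}

theorem le_finrank_coordSpan_inf_dotPerp {m : ℕ} (hm : m ≤ k) (A : Submodule F (Fin k → F)) :
    m ≤ Module.finrank F (coordSpan F k m ⊓ dotPerp A : Submodule F (Fin k → F)) +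
      Module.finrank F A := by
  have h1 := Submodule.finrank_sup_add_finrank_inf_eq (coordSpan F k m) (dotPerp A)
  have h2 := finrank_le_of_ambient (coordSpan F k m ⊔ dotPerp A)
  rw [finrank_coordSpan hm, finrank_dotPerp] at h1
  have h3 := finrank_le_of_ambient A
  omega

theorem mem_dotPerp_coordSpan {m : ℕ} {a : Fin k → F} :
    a ∈ dotPerp (coordSpan F k m) ↔ ∀ b : Fin k, (b : ℕ) < m → a b = 0 := by
  rw [mem_dotPerp]
  constructor
  · intro h b hb
    have := h (Pi.single b 1) (Submodule.subset_span ⟨b, hb, rfl⟩)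
    simpa using this
  · intro h x hx
    rw [mem_coordSpan] at hx
    refine Finset.sum_eq_zero fun b _ => ?_
    rcases Nat.lt_or_ge b m with hb | hb
    · rw [h b hb, mul_zero]
    · rw [hx b hb, zero_mul]

theorem dotPerp_antitone {A B : Submodule F (Fin k → F)} (h : A ≤ B) : dotPerp B ≤ dotPerp A :=
  fun _ hx a ha => hx a (h ha)

theorem le_dotPerp_span_singleton {A : Submodule F (Fin k → F)} {a : Fin k → F} :
    A ≤ dotPerp (Submodule.span F {a}) ↔ a ∈ dotPerp A := by
  constructor
  · intro h
    rw [mem_dotPerp]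
    intro x hx
    rw [dotProduct_comm]
    exact mem_dotPerp.mp (h hx) a (Submodule.mem_span_singleton_self a)
  · intro h x hx
    rw [mem_dotPerp]
    intro y hy
    obtain ⟨c, rfl⟩ := Submodule.mem_span_singleton.mp hy
    rw [smul_dotProduct, dotProduct_comm, mem_dotPerp.mp h x hx, smul_zero]

theorem finrank_coordSpan_inf_dotPerp_span {m : ℕ} (hm : m ≤ k) {a : Fin k → F} (ha : a ≠ 0)
    [Decidable (a ∈ dotPerp (coordSpan F k m))] :
    Module.finrank F (coordSpan F k m ⊓ dotPerp (Submodule.span F {a}) :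
        Submodule F (Fin k → F)) =
      if a ∈ dotPerp (coordSpan F k m) then m else m - 1 := by
  split_ifs with h
  · rw [inf_eq_left.mpr (le_dotPerp_span_singleton.mpr h), finrank_coordSpan hm]
  · have h1 := le_finrank_coordSpan_inf_dotPerp hm (Submodule.span F {a})
    rw [finrank_span_singleton ha] at h1
    have h2 : Module.finrank F (coordSpan F k m ⊓ dotPerp (Submodule.span F {a}) :
        Submodule F (Fin k → F)) < Module.finrank F (coordSpan F k m) := by
      refine Submodule.finrank_lt_finrank_of_lt (inf_lt_left.mpr fun h' => h ?_)
      exact le_dotPerp_span_singleton.mp h'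
    rw [finrank_coordSpan hm] at h2
    omega

end Flag

/-! ### Weight distribution and minimum distance -/

section Weights

variable {F : Type*} [Field F] [Fintype F] [DecidableEq F] {k s t n : ℕ} {u : ℕ → ℕ}

/-- There are `s - 1 ≤ t` terms, each below `q^(k-1)`. Hence the truncated subtraction in `flagDist`
is a genuine one with positive result. -/
theorem sum_pow_lt (hu : IsFlagType k s u) (hst : s ≤ t + 1) {q : ℕ} (hq : 1 < q) :
    ∑ i ∈ Finset.Icc 2 s, q ^ (u i - 1) < t * q ^ (k - 1) := by
  have h2 := hu.two_le
  calc ∑ i ∈ Finset.Icc 2 s, q ^ (u i - 1) < ∑ i ∈ Finset.Icc 2 s, q ^ (k - 1) := by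
        refine Finset.sum_lt_sum_of_nonempty ⟨2, by simp [h2]⟩ fun i hi => ?_
        rw [Finset.mem_Icc] at hi
        have h3 := hu.lt_last hi.2
        have h4 := hu.two_le_of hi.1 (by omega)
        exact Nat.pow_lt_pow_right hq (by omega)
    _ = (s - 1) * q ^ (k - 1) := by
        rw [Finset.sum_const, Nat.card_Icc, smul_eq_mul]; rfl
    _ ≤ t * q ^ (k - 1) := Nat.mul_le_mul_right _ (by omega)

/-- The minimum distance of the code. -/
def flagDist (q k s t : ℕ) (u : ℕ → ℕ) : ℕ :=
  t * q ^ (k - 1) - ∑ i ∈ Finset.Icc 2 s, q ^ (u i - 1)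

theorem flagDist_add (hu : IsFlagType k s u) (hst : s ≤ t + 1) {q : ℕ} (hq : 1 < q) :
    flagDist q k s t u + ∑ i ∈ Finset.Icc 2 s, q ^ (u i - 1) = t * q ^ (k - 1) :=
  Nat.sub_add_cancel (sum_pow_lt hu hst hq).le

theorem flagDist_pos (hu : IsFlagType k s u) (hst : s ≤ t + 1) {q : ℕ} (hq : 1 < q) :
    0 < flagDist q k s t u := Nat.sub_pos_of_lt (sum_pow_lt hu hst hq)

/-- The weight of the words that vanish on the first `u l`, but not on the first `u (l + 1)`
coordinates. -/
def levelWeight (q k s t : ℕ) (u : ℕ → ℕ) (l : ℕ) : ℕ :=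
  flagDist q k s t u + if l = 0 then 1 else ∑ i ∈ Finset.Icc 2 l, q ^ (u i - 1)

theorem levelWeight_pos (hu : IsFlagType k s u) (hst : s ≤ t + 1) {q : ℕ} (hq : 1 < q) (l : ℕ) :
    0 < levelWeight q k s t u l := (flagDist_pos hu hst hq).trans_le (Nat.le_add_right _ _)

/-- From level 1 on, the partial sums increase strictly from 0. Level 0 contributes 1, which they
skip because their first summand `q^(u_2-1)` already exceeds 1. -/
theorem levelWeight_injOn (hu : IsFlagType k s u) {q : ℕ} (hq : 1 < q) {l l' : ℕ}
    (hl : l ≤ s) (hl' : l' ≤ s) (h : levelWeight q k s t u l = levelWeight q k s t u l') :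
    l = l' := by
  have hpos : ∀ i, 0 < q ^ (u i - 1) := fun i => Nat.pow_pos (by omega)
  have h2 : ∀ l, 2 ≤ l → l ≤ s → 1 < ∑ i ∈ Finset.Icc 2 l, q ^ (u i - 1) := by
    intro l hl hls
    have h4 := hu.two_le_of le_rfl (by omega : 2 ≤ s + 1)
    calc 1 < q ^ (u 2 - 1) := Nat.one_lt_pow (by omega) hq
      _ ≤ _ := Finset.single_le_sum (f := fun i => q ^ (u i - 1)) (fun i _ => Nat.zero_le _)
          (by simp [hl])
  have hlt : ∀ l l', 1 ≤ l → l < l' →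
      ∑ i ∈ Finset.Icc 2 l, q ^ (u i - 1) < ∑ i ∈ Finset.Icc 2 l', q ^ (u i - 1) := by
    intro l l' hl hll
    refine Finset.sum_lt_sum_of_subset (Finset.Icc_subset_Icc_right hll.le) (i := l')
      (by simp; omega) (by simp; omega) (hpos _) fun i _ _ => Nat.zero_le _
  have hone : ∑ i ∈ Finset.Icc 2 1, q ^ (u i - 1) = 0 := by simp
  simp only [levelWeight, Nat.add_left_cancel_iff] at h
  have key : ∀ l l', l ≤ s → l' ≤ s → l < l' →
      (if l = 0 then 1 else ∑ i ∈ Finset.Icc 2 l, q ^ (u i - 1)) ≠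
      (if l' = 0 then 1 else ∑ i ∈ Finset.Icc 2 l', q ^ (u i - 1)) := by
    intro l l' hl hl' hll
    rw [if_neg (show l' ≠ 0 by omega)]
    split_ifs with h0
    · rcases Nat.lt_or_ge l' 2 with h | h
      · have : l' = 1 := by omega
        rw [this, hone]; simp
      · exact (h2 l' h hl').ne
    · exact (hlt l l' (by omega) hll).ne
  rcases lt_trichotomy l l' with hh | hh | hh
  · exact absurd h (key _ _ hl hl' hh)
  · exact hh
  · exact absurd h.symm (key _ _ hl' hl hh)

/-- The support formula on the line through `a`: where `a^⊥` fails to contain `U_i`, the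
intersection loses one dimension and `[u_i] - [u_i - 1] = q^(u_i-1)` points. -/
theorem hammingNorm_add_sum (hu : IsFlagType k s u) {φ : (Fin k → F) →ₗ[F] (Fin n → F)}
    (hφ : SupportFormula (Fintype.card F) k s t u φ) {a : Fin k → F} (ha : a ≠ 0)
    [∀ i, Decidable (a ∈ dotPerp (coordSpan F k (u i)))] :
    hammingNorm (φ a) + ∑ i ∈ Finset.Icc 2 s,
        (if a ∈ dotPerp (coordSpan F k (u i)) then 0 else Fintype.card F ^ (u i - 1)) =
      t * Fintype.card F ^ (k - 1) +
        if a ∈ dotPerp (coordSpan F k (u 1)) then 0 else 1 := by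
  have h := hφ (Submodule.span F {a})
  have hk := hu.three_le
  rw [Submodule.map_span, Set.image_singleton, suppWeight_span_singleton,
    finrank_span_singleton ha,
    finrank_coordSpan_inf_dotPerp_span (hu.le_last (by omega)) ha] at h
  have h1 : ∑ i ∈ Finset.Icc 2 s, numPoints (Fintype.card F) (u i) =
      ∑ i ∈ Finset.Icc 2 s, numPoints (Fintype.card F) (Module.finrank F
        (coordSpan F k (u i) ⊓ dotPerp (Submodule.span F {a}) : Submodule F (Fin k → F))) +
      ∑ i ∈ Finset.Icc 2 s,
        (if a ∈ dotPerp (coordSpan F k (u i)) then 0 else Fintype.card F ^ (u i - 1)) := by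
    rw [← Finset.sum_add_distrib]
    refine Finset.sum_congr rfl fun i hi => ?_
    rw [Finset.mem_Icc] at hi
    rw [finrank_coordSpan_inf_dotPerp_span (hu.le_last (by omega)) ha]
    split_ifs
    · rfl
    · rw [← numPoints_succ]
      have := hu.two_le_of hi.1 (by omega)
      congr 1
      omega
  have h2 : t * numPoints (Fintype.card F) k = t * numPoints (Fintype.card F) (k - 1) +
      t * Fintype.card F ^ (k - 1) := by
    rw [← mul_add, ← numPoints_succ]
    congr 2
    omega
  split_ifs at h ⊢ with h3
  · rw [hu.one, numPoints_one] at h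
    omega
  · rw [hu.one, numPoints_zero] at h
    omega

theorem hammingNorm_of_level (hu : IsFlagType k s u) (hst : s ≤ t + 1)
    {φ : (Fin k → F) →ₗ[F] (Fin n → F)} (hφ : SupportFormula (Fintype.card F) k s t u φ)
    {a : Fin k → F} {l : ℕ} (hl : l ≤ s) (h1 : a ∈ dotPerp (coordSpan F k (u l)))
    (h2 : a ∉ dotPerp (coordSpan F k (u (l + 1)))) :
    hammingNorm (φ a) = levelWeight (Fintype.card F) k s t u l := by
  classical
  have ha : a ≠ 0 := by
    rintro rfl
    exact h2 (Submodule.zero_mem _)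
  have hiff : ∀ i ≤ s, (a ∈ dotPerp (coordSpan F k (u i)) ↔ i ≤ l) := by
    intro i hi
    constructor
    · intro h
      by_contra hcon
      exact h2 (dotPerp_antitone (coordSpan_mono (hu.le (by omega) (by omega))) h)
    · intro h
      exact dotPerp_antitone (coordSpan_mono (hu.le h (by omega))) h1
  have h := hammingNorm_add_sum hu hφ ha
  have hs := hu.two_le
  have hd := flagDist_add hu hst (Fintype.one_lt_card : 1 < Fintype.card F)
  have hsum : ∑ i ∈ Finset.Icc 2 s,
        (if a ∈ dotPerp (coordSpan F k (u i)) then 0 else Fintype.card F ^ (u i - 1)) +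
      ∑ i ∈ Finset.Icc 2 l, Fintype.card F ^ (u i - 1) =
      ∑ i ∈ Finset.Icc 2 s, Fintype.card F ^ (u i - 1) := by
    have : Finset.Icc 2 l = (Finset.Icc 2 s).filter (· ≤ l) := by
      ext i; simp only [Finset.mem_Icc, Finset.mem_filter]; omega
    rw [this, Finset.sum_filter, ← Finset.sum_add_distrib]
    refine Finset.sum_congr rfl fun i hi => ?_
    rw [Finset.mem_Icc] at hi
    simp only [hiff i hi.2]
    split_ifs <;> simp
  simp only [hiff 1 (by omega)] at h
  rw [levelWeight]
  -- Only at level 0 is `a` not orthogonal to `U_1`; then the single column of `G_1` adds 1 to the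
  -- weight.
  rcases Nat.eq_zero_or_pos l with rfl | h3
  · rw [if_neg (by omega)] at h
    rw [if_pos rfl]
    rw [Finset.Icc_eq_empty (by omega : ¬ 2 ≤ 0), Finset.sum_empty] at hsum
    omega
  · rw [if_pos (by omega)] at h
    rw [if_neg (by omega)]
    omega

-- Every vector is orthogonal to `U_0 = 0`, and only zero is orthogonal to `U_{s+1}`, the whole
-- space.
omit [Fintype F] [DecidableEq F] in
theorem exists_level (hu : IsFlagType k s u) {a : Fin k → F} (ha : a ≠ 0) :
    ∃ l ≤ s, a ∈ dotPerp (coordSpan F k (u l)) ∧ a ∉ dotPerp (coordSpan F k (u (l + 1))) := by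
  by_contra! hcon
  have : ∀ l ≤ s + 1, a ∈ dotPerp (coordSpan F k (u l)) := by
    intro l
    induction l with
    | zero => intro _; rw [mem_dotPerp_coordSpan, hu.zero]; simp
    | succ l ih => exact fun hl => hcon l (by omega) (ih (by omega))
  have h := this (s + 1) le_rfl
  rw [hu.last, mem_dotPerp_coordSpan] at h
  exact ha (funext fun b => h b b.2)

theorem injective_of_supportFormula (hu : IsFlagType k s u) (hst : s ≤ t + 1)
    {φ : (Fin k → F) →ₗ[F] (Fin n → F)} (hφ : SupportFormula (Fintype.card F) k s t u φ) :
    Function.Injective φ := by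
  rw [← LinearMap.ker_eq_bot, LinearMap.ker_eq_bot']
  intro a ha
  by_contra hne
  obtain ⟨l, hl, h1, h2⟩ := exists_level hu hne
  have h := hammingNorm_of_level hu hst hφ hl h1 h2
  rw [ha, hammingNorm_zero] at h
  exact absurd h (levelWeight_pos hu hst Fintype.one_lt_card l).ne

omit [DecidableEq F] in
theorem ncard_dotPerp_coordSpan {m : ℕ} (hm : m ≤ k) :
    (dotPerp (coordSpan F k m) : Set (Fin k → F)).ncard = Fintype.card F ^ (k - m) := by
  rw [← Nat.card_coe_set_eq]
  have := Module.natCard_eq_pow_finrank (K := F) (V := dotPerp (coordSpan F k m))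
  rw [finrank_dotPerp, finrank_coordSpan hm, Nat.card_eq_fintype_card (α := F)] at this
  exact this

omit [DecidableEq F] in
theorem ncard_level (hu : IsFlagType k s u) {l : ℕ} (hl : l ≤ s) :
    ({a | a ∈ dotPerp (coordSpan F k (u l)) ∧ a ∉ dotPerp (coordSpan F k (u (l + 1)))}.ncard : ℚ) =
      (Fintype.card F : ℚ) ^ (k - u l) - (Fintype.card F : ℚ) ^ (k - u (l + 1)) := by
  have hsub : (dotPerp (coordSpan F k (u (l + 1))) : Set (Fin k → F)) ⊆
      dotPerp (coordSpan F k (u l)) :=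
    dotPerp_antitone (coordSpan_mono (hu.le (by omega) (by omega)))
  have h := Set.ncard_sdiff_add_ncard_of_subset hsub
  rw [ncard_dotPerp_coordSpan (hu.le_last (by omega)),
    ncard_dotPerp_coordSpan (hu.le_last (by omega))] at h
  rw [eq_sub_iff_add_eq]
  exact_mod_cast h

omit [Fintype F] in
theorem weightCount_zero (C : Submodule F (Fin n → F)) : weightCount C 0 = 1 := by
  have : {x : Fin n → F | x ∈ C ∧ hammingNorm x = 0} = {0} := by
    ext x
    simp only [Set.mem_ofPred_eq, hammingNorm_eq_zero, Set.mem_singleton_iff]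
    exact ⟨fun h => h.2, fun h => ⟨h ▸ C.zero_mem, h⟩⟩
  rw [weightCount, this, Set.ncard_singleton]

omit [Fintype F] in
theorem weightCount_range {φ : (Fin k → F) →ₗ[F] (Fin n → F)} (hφ : Function.Injective φ)
    (j : ℕ) : weightCount (LinearMap.range φ) j = {a | hammingNorm (φ a) = j}.ncard := by
  rw [weightCount, ← Set.ncard_image_of_injective _ hφ]
  congr 1
  ext x
  constructor
  · rintro ⟨⟨a, rfl⟩, h⟩
    exact ⟨a, h, rfl⟩
  · rintro ⟨a, h, rfl⟩
    exact ⟨⟨a, rfl⟩, h⟩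

theorem weightCount_level (hu : IsFlagType k s u) (hst : s ≤ t + 1)
    {φ : (Fin k → F) →ₗ[F] (Fin n → F)} (hφ : SupportFormula (Fintype.card F) k s t u φ)
    {l : ℕ} (hl : l ≤ s) :
    (weightCount (LinearMap.range φ) (levelWeight (Fintype.card F) k s t u l) : ℚ) =
      (Fintype.card F : ℚ) ^ (k - u l) - (Fintype.card F : ℚ) ^ (k - u (l + 1)) := by
  rw [weightCount_range (injective_of_supportFormula hu hst hφ), ← ncard_level hu hl]
  congr 2
  ext a
  constructor
  · intro h
    have ha : a ≠ 0 := by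
      rintro rfl
      rw [Set.mem_ofPred_eq, map_zero, hammingNorm_zero] at h
      exact absurd h (levelWeight_pos hu hst Fintype.one_lt_card l).ne
    obtain ⟨l', hl', h1, h2⟩ := exists_level hu ha
    have h3 := hammingNorm_of_level hu hst hφ hl' h1 h2
    have : l = l' := levelWeight_injOn hu Fintype.one_lt_card hl hl' (h.symm.trans h3)
    exact this ▸ ⟨h1, h2⟩
  · rintro ⟨h1, h2⟩
    exact hammingNorm_of_level hu hst hφ hl h1 h2

theorem weightCount_eq_zero (hu : IsFlagType k s u) (hst : s ≤ t + 1)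
    {φ : (Fin k → F) →ₗ[F] (Fin n → F)} (hφ : SupportFormula (Fintype.card F) k s t u φ)
    {j : ℕ} (hj0 : j ≠ 0) (hj : ∀ l ≤ s, j ≠ levelWeight (Fintype.card F) k s t u l) :
    weightCount (LinearMap.range φ) j = 0 := by
  rw [weightCount_range (injective_of_supportFormula hu hst hφ), Set.ncard_eq_zero]
  ext a
  simp only [Set.mem_ofPred_eq, Set.mem_empty_iff_false, iff_false]
  intro h
  rcases eq_or_ne a 0 with rfl | ha
  · exact hj0 (by simpa using h.symm)
  · obtain ⟨l, hl, h1, h2⟩ := exists_level hu ha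
    exact hj l hl (h.symm.trans (hammingNorm_of_level hu hst hφ hl h1 h2))

theorem minDist_eq_flagDist (hu : IsFlagType k s u) (hst : s ≤ t + 1)
    {φ : (Fin k → F) →ₗ[F] (Fin n → F)} (hφ : SupportFormula (Fintype.card F) k s t u φ) :
    minDist (LinearMap.range φ) = flagDist (Fintype.card F) k s t u := by
  have hs := hu.two_le
  have hinj := injective_of_supportFormula hu hst hφ
  apply IsLeast.csInf_eq
  constructor
  -- Level 1 attains the minimum, and it is nonempty because `u_1 < u_2`.
  · have hlev := ncard_level (F := F) hu (l := 1) (by omega)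
    have hq : (1 : ℚ) < (Fintype.card F : ℚ) := by
      exact_mod_cast (Fintype.one_lt_card : 1 < Fintype.card F)
    have h2 := hu.lt_succ 1 (by omega)
    have h3 := hu.le_last (i := 2) (by omega)
    have hpos : 0 < {a | a ∈ dotPerp (coordSpan F k (u 1)) ∧
        a ∉ dotPerp (coordSpan F k (u (1 + 1)))}.ncard := by
      have : (0 : ℚ) < (Fintype.card F : ℚ) ^ (k - u 1) - (Fintype.card F : ℚ) ^ (k - u (1 + 1)) :=
        sub_pos.mpr (pow_lt_pow_right₀ hq (by
          rw [show 1 + 1 = 2 from rfl] at h2 ⊢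
          omega))
      rw [← hlev] at this
      exact_mod_cast this
    obtain ⟨a, h4, h5⟩ := (Set.ncard_pos).mp hpos
    have hw := hammingNorm_of_level hu hst hφ (by omega) h4 h5
    refine ⟨φ a, ⟨a, rfl⟩, 0, Submodule.zero_mem _, ?_, ?_⟩
    · intro h
      rw [h, hammingNorm_zero] at hw
      exact absurd hw (levelWeight_pos hu hst Fintype.one_lt_card 1).ne
    · rw [hammingDist_zero_right, hw]
      simp [levelWeight]
  · rintro w ⟨_, ⟨a, rfl⟩, _, ⟨b, rfl⟩, hne, rfl⟩
    have hab : a - b ≠ 0 := by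
      intro h
      exact hne (congrArg φ (sub_eq_zero.mp h))
    obtain ⟨l, hl, h1, h2⟩ := exists_level hu hab
    rw [hammingDist_comm, hammingDist_eq_hammingNorm, neg_add_eq_sub, ← map_sub,
      hammingNorm_of_level hu hst hφ hl h1 h2]
    exact Nat.le_add_right _ _

end Weights

/-! ### Generalized Hamming weights -/

section GenWeights

variable {F : Type*} [Field F] {k s t n : ℕ} {u : ℕ → ℕ}

theorem genHammingWeight_range_eq {φ : (Fin k → F) →ₗ[F] (Fin n → F)}
    (hφ : Function.Injective φ) {r w : ℕ}
    (hle : ∀ A : Submodule F (Fin k → F), Module.finrank F A = r → w ≤ suppWeight (A.map φ))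
    (hex : ∃ A : Submodule F (Fin k → F), Module.finrank F A = r ∧ suppWeight (A.map φ) = w) :
    genHammingWeight (LinearMap.range φ) r = w := by
  apply IsLeast.csInf_eq
  constructor
  · obtain ⟨A, hA, hw⟩ := hex
    exact ⟨A.map φ, LinearMap.map_le_range, by
      rw [← (Submodule.equivMapOfInjective φ hφ A).finrank_eq, hA], hw⟩
  · rintro w' ⟨U, hU, hr, rfl⟩
    have hmap : (U.comap φ).map φ = U := Submodule.map_comap_eq_of_le hU
    rw [← hmap]
    apply hle
    rw [← hr]
    conv_rhs => rw [← hmap]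
    exact (Submodule.equivMapOfInjective φ hφ _).finrank_eq

theorem exists_dotPerp_eq (V : Submodule F (Fin k → F)) {r : ℕ} (hr : r ≤ k)
    (hV : Module.finrank F V = k - r) :
    ∃ A : Submodule F (Fin k → F), Module.finrank F A = r ∧ dotPerp A = V := by
  refine ⟨dotPerp V, ?_, dotPerp_dotPerp V⟩
  rw [finrank_dotPerp, hV]
  omega

theorem card_fin_filter_ge_lt {a b : ℕ} (hb : b ≤ k) :
    #{x : Fin k | a ≤ (x : ℕ) ∧ (x : ℕ) < b} = b - a := by
  rw [← Nat.card_Ico, ← Finset.card_map Fin.valEmbedding]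
  congr 1
  ext x
  simp only [Finset.mem_map, Finset.mem_filter, Finset.mem_univ, true_and, Finset.mem_Ico,
    Fin.valEmbedding_apply]
  constructor
  · rintro ⟨y, hy, rfl⟩; exact hy
  · intro h
    exact ⟨⟨x, by omega⟩, h, rfl⟩

/-- Tail coordinate subspaces meet the coordinate flag generically. -/
theorem finrank_coordSpan_inf_tail {r m : ℕ} (hm : m ≤ k) :
    Module.finrank F (coordSpan F k m ⊓ coordSub F {a : Fin k | r ≤ (a : ℕ)} :
      Submodule F (Fin k → F)) = m - r := by
  rw [coordSpan_eq_coordSub, coordSub_inf, finrank_coordSub, ← card_fin_filter_ge_lt hm]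
  congr 1
  ext a
  simp [and_comm]

/-- Keeping the first coordinate and dropping the next `r` retains `U_1` while meeting `U_m` in
dimension `m - r` for `m > r`. For `1 ≤ m ≤ r` the truncated expression gives 1, the share of `U_1`.
-/
theorem finrank_coordSpan_inf_zero_tail {r m : ℕ} (hm : m ≤ k) (h1 : 1 ≤ m) :
    Module.finrank F (coordSpan F k m ⊓ coordSub F {a : Fin k | (a : ℕ) = 0 ∨ r + 1 ≤ (a : ℕ)} :
      Submodule F (Fin k → F)) = m - (r + 1) + 1 := by
  rw [coordSpan_eq_coordSub, coordSub_inf, finrank_coordSub, ← card_fin_filter_ge_lt hm]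
  have : ({a : Fin k | (a : ℕ) < m} : Finset (Fin k)) ∩
      ({a : Fin k | (a : ℕ) = 0 ∨ r + 1 ≤ (a : ℕ)} : Finset (Fin k)) =
      insert (⟨0, by omega⟩ : Fin k)
        ({x : Fin k | r + 1 ≤ (x : ℕ) ∧ (x : ℕ) < m} : Finset (Fin k)) := by
    ext a
    simp only [Finset.mem_inter, Finset.mem_filter, Finset.mem_univ, true_and, Finset.mem_insert,
      Fin.ext_iff]
    omega
  rw [this, Finset.card_insert_of_notMem (by simp)]

/-- The lower bounds `dim U_i ∩ V ≥ u_i - r` are attained simultaneously by coordinate subspaces.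
For `r < u_2` the optimal one also contains `U_1`, saving one point; for `r ≥ u_2` dropping the
first `r` coordinates is optimal. Truncation makes the terms with `u_i ≤ r` vanish. -/
theorem genHammingWeight_add (hu : IsFlagType k s u) {q : ℕ}
    {φ : (Fin k → F) →ₗ[F] (Fin n → F)} (hφ : SupportFormula q k s t u φ)
    (hinj : Function.Injective φ) {r : ℕ} (hr1 : 1 ≤ r) (hr : r ≤ k) :
    genHammingWeight (LinearMap.range φ) r + t * numPoints q (k - r) +
        ∑ i ∈ Finset.Icc 2 s, numPoints q (u i) =
      t * numPoints q k + (if r < u 2 then 0 else 1) +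
        ∑ i ∈ Finset.Icc 2 s, numPoints q (u i - r) := by
  have hs := hu.two_le
  have hk := hu.three_le
  have htail : ∃ A : Submodule F (Fin k → F), Module.finrank F A = r ∧
      suppWeight (A.map φ) + t * numPoints q (k - r) + ∑ i ∈ Finset.Icc 2 s, numPoints q (u i) =
      t * numPoints q k + (if r < u 2 then 0 else 1) +
        ∑ i ∈ Finset.Icc 2 s, numPoints q (u i - r) := by
    split_ifs with h
    · have hrk : r < k := h.trans (hu.lt_last hs)
      obtain ⟨A, hA, hperp⟩ := exists_dotPerp_eq
        (coordSub F {a : Fin k | (a : ℕ) = 0 ∨ r + 1 ≤ (a : ℕ)}) hr (by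
          rw [← top_inf_eq (coordSub F _), ← coordSpan_self,
            finrank_coordSpan_inf_zero_tail le_rfl (by omega)]
          omega)
      refine ⟨A, hA, ?_⟩
      have hf := hφ A
      rw [hA, hperp, finrank_coordSpan_inf_zero_tail (hu.le_last (by omega)) hu.one.ge, hu.one,
        show 1 - (r + 1) + 1 = 1 by omega, numPoints_one] at hf
      have hsum : ∑ i ∈ Finset.Icc 2 s, numPoints q (Module.finrank F (coordSpan F k (u i) ⊓
          coordSub F {a : Fin k | (a : ℕ) = 0 ∨ r + 1 ≤ (a : ℕ)} : Submodule F (Fin k → F))) =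
          ∑ i ∈ Finset.Icc 2 s, numPoints q (u i - r) := by
        refine Finset.sum_congr rfl fun i hi => ?_
        rw [Finset.mem_Icc] at hi
        have h2 := hu.le hi.1 (by omega : i ≤ s + 1)
        rw [finrank_coordSpan_inf_zero_tail (hu.le_last (by omega)) (by omega)]
        congr 1
        omega
      omega
    · obtain ⟨A, hA, hperp⟩ := exists_dotPerp_eq
        (coordSub F {a : Fin k | r ≤ (a : ℕ)}) hr (by
          rw [← top_inf_eq (coordSub F _), ← coordSpan_self, finrank_coordSpan_inf_tail le_rfl])
      refine ⟨A, hA, ?_⟩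
      have hf := hφ A
      rw [hA, hperp, finrank_coordSpan_inf_tail (hu.le_last (by omega)), hu.one,
        show 1 - r = 0 by omega, numPoints_zero] at hf
      have hsum : ∑ i ∈ Finset.Icc 2 s, numPoints q (Module.finrank F (coordSpan F k (u i) ⊓
          coordSub F {a : Fin k | r ≤ (a : ℕ)} : Submodule F (Fin k → F))) =
          ∑ i ∈ Finset.Icc 2 s, numPoints q (u i - r) := by
        refine Finset.sum_congr rfl fun i hi => ?_
        rw [Finset.mem_Icc] at hi
        rw [finrank_coordSpan_inf_tail (hu.le_last (by omega))]
      omega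
  obtain ⟨A₀, hA₀, hw₀⟩ := htail
  rw [genHammingWeight_range_eq hinj (w := suppWeight (A₀.map φ)) ?_ ⟨A₀, hA₀, rfl⟩, hw₀]
  intro A hA
  have hf := hφ A
  rw [hA] at hf
  have hge : ∀ i ∈ Finset.Icc 2 s, numPoints q (u i - r) ≤ numPoints q (Module.finrank F
      (coordSpan F k (u i) ⊓ dotPerp A : Submodule F (Fin k → F))) := by
    intro i hi
    rw [Finset.mem_Icc] at hi
    apply numPoints_mono
    have := le_finrank_coordSpan_inf_dotPerp (hu.le_last (show i ≤ s + 1 by omega)) A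
    omega
  have h1 : Module.finrank F (coordSpan F k (u 1) ⊓ dotPerp A : Submodule F (Fin k → F)) ≤ 1 := by
    calc _ ≤ Module.finrank F (coordSpan F k (u 1)) := Submodule.finrank_mono inf_le_left
      _ = 1 := by rw [finrank_coordSpan (hu.le_last (by omega)), hu.one]
  have hcases : numPoints q
        (Module.finrank F (coordSpan F k (u 1) ⊓ dotPerp A : Submodule F (Fin k → F))) +
      ∑ i ∈ Finset.Icc 2 s, numPoints q (u i - r) ≤
      (if r < u 2 then 1 else 0) + ∑ i ∈ Finset.Icc 2 s, numPoints q (Module.finrank F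
        (coordSpan F k (u i) ⊓ dotPerp A : Submodule F (Fin k → F))) := by
    rcases Nat.eq_zero_or_pos (Module.finrank F
      (coordSpan F k (u 1) ⊓ dotPerp A : Submodule F (Fin k → F))) with h0 | h0
    · rw [h0, numPoints_zero]
      have := Finset.sum_le_sum hge
      omega
    · rw [show Module.finrank F
        (coordSpan F k (u 1) ⊓ dotPerp A : Submodule F (Fin k → F)) = 1 by omega, numPoints_one]
      split_ifs with h
      · have := Finset.sum_le_sum hge
        omega
      · rw [zero_add, Nat.one_add_le_iff]
        -- If `V` contains `U_1`, it meets `U_2` nontrivially although `u_2 - r = 0`; this loss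
        -- offsets the saved point.
        refine Finset.sum_lt_sum hge ⟨2, by simp [hs], ?_⟩
        rw [show u 2 - r = 0 by omega, numPoints_zero]
        have h2 : 1 ≤ Module.finrank F
            (coordSpan F k (u 2) ⊓ dotPerp A : Submodule F (Fin k → F)) :=
          h0.trans_le (Submodule.finrank_mono (inf_le_inf_right _
            (coordSpan_mono (hu.le (by omega) (by omega)))))
        have := numPoints_mono q h2
        rw [numPoints_one] at this
        omega
  split_ifs at hw₀ hcases <;> omega

end GenWeights

/-! ### The ceilings in the Griesmer sum -/

section Ceilings

variable {k s t : ℕ} {u : ℕ → ℕ}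

theorem sum_ite_pow_sub (q : ℕ) {a K : ℕ} (h : a ≤ K) :
    ∑ i ∈ Finset.Icc 1 K, (if i ≤ a then q ^ (a - i) else 0) = numPoints q a := by
  rw [← Finset.sum_filter, numPoints]
  refine Finset.sum_nbij' (fun i => a - i) (fun i => a - i) ?_ ?_ ?_ ?_ fun _ _ => rfl <;>
    simp only [Finset.mem_filter, Finset.mem_Icc, Finset.mem_range] <;> omega

/-- A sum of distinct powers of `q` with exponents below `i` is less than `q^i`. The condition `r ≤
u 2` keeps the truncated exponents distinct. -/
theorem IsFlagType.sum_pow_filter_lt (hu : IsFlagType k s u) {q : ℕ} (hq : 1 < q) {r : ℕ}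
    (hr : r ≤ u 2) (i : ℕ) :
    ∑ j ∈ Finset.Icc 2 s with ¬ i ≤ u j - r, q ^ (u j - r) < q ^ i := by
  have hinj : Set.InjOn (fun j => u j - r) ((Finset.Icc 2 s).filter fun j => ¬ i ≤ u j - r) := by
    have key : ∀ j j', 2 ≤ j → j' ≤ s → j < j' → u j - r < u j' - r := by
      intro j j' h1 h2 h3
      have := hu.lt h3 (by omega)
      have := hu.le h1 (by omega : j ≤ s + 1)
      omega
    intro j hj j' hj' h
    simp only [Finset.coe_filter, Finset.mem_Icc, Set.mem_ofPred_eq] at hj hj'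
    rcases lt_trichotomy j j' with hh | hh | hh
    · exact absurd h (key _ _ hj.1.1 hj'.1.2 hh).ne
    · exact hh
    · exact absurd h.symm (key _ _ hj'.1.1 hj.1.2 hh).ne
  have := Finset.sum_image (f := fun m => q ^ m) hinj
  rw [← this]
  refine Nat.geomSum_lt hq fun m hm => ?_
  obtain ⟨j, hj, rfl⟩ := Finset.mem_image.mp hm
  simp only [Finset.mem_filter] at hj
  omega

/-- Powers with exponent at least `i` are divisible by `q^i`; the others sum to `R < q^i`. The
numerator is thus a multiple of `q^i` minus `R - ε`, and `0 ≤ R - ε < q^i` lets the ceiling absorb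
the difference. -/
theorem IsFlagType.ceil_div_pow (hu : IsFlagType k s u) {q : ℕ} (hq : 1 < q) {r : ℕ}
    (hr : r ≤ u 2) {ε : ℚ} (h0 : 0 ≤ ε) (h1 : ε < 1) (hε : ε = 0 ∨ r = u 2) {i : ℕ}
    (hi : 1 ≤ i) (hik : i ≤ k - r) :
    ⌈((t : ℚ) * (q : ℚ) ^ (k - r) - ∑ j ∈ Finset.Icc 2 s, (q : ℚ) ^ (u j - r) + ε) /
        (q : ℚ) ^ i⌉ =
      ((t * q ^ (k - r - i) : ℕ) : ℤ) -
        ((∑ j ∈ Finset.Icc 2 s, (if i ≤ u j - r then q ^ (u j - r - i) else 0) : ℕ) : ℤ) := by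
  have hlt := hu.sum_pow_filter_lt hq hr i
  have hsplit : ∑ j ∈ Finset.Icc 2 s, q ^ (u j - r) =
      q ^ i * (∑ j ∈ Finset.Icc 2 s, (if i ≤ u j - r then q ^ (u j - r - i) else 0)) +
        ∑ j ∈ Finset.Icc 2 s with ¬ i ≤ u j - r, q ^ (u j - r) := by
    rw [Finset.mul_sum, Finset.sum_filter, ← Finset.sum_add_distrib]
    refine Finset.sum_congr rfl fun j _ => ?_
    split_ifs with h
    · rw [add_zero, ← pow_add, Nat.add_sub_cancel' h]
    · simp
  have hge : ε ≤ ((∑ j ∈ Finset.Icc 2 s with ¬ i ≤ u j - r, q ^ (u j - r) : ℕ) : ℚ) := by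
    rcases hε with rfl | rfl
    · exact Nat.cast_nonneg _
    -- For `r = u 2` the exponent of the term `j = 2` is 0, below `i ≥ 1`, so `R ≥ 1 > ε`.
    · have h2 : q ^ (u 2 - u 2) ≤
          ∑ j ∈ Finset.Icc 2 s with ¬ i ≤ u j - u 2, q ^ (u j - u 2) :=
        Finset.single_le_sum (f := fun j => q ^ (u j - u 2)) (fun _ _ => Nat.zero_le _)
          (by simp [hu.two_le]; omega)
      rw [Nat.sub_self, pow_zero] at h2
      exact h1.le.trans (by exact_mod_cast h2)
  have hpow : t * q ^ (k - r) = q ^ i * (t * q ^ (k - r - i)) := by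
    rw [mul_left_comm, ← pow_add, Nat.add_sub_cancel' hik]
  set R := ∑ j ∈ Finset.Icc 2 s with ¬ i ≤ u j - r, q ^ (u j - r)
  set B := ∑ j ∈ Finset.Icc 2 s, (if i ≤ u j - r then q ^ (u j - r - i) else 0)
  have hsplit' : ∑ j ∈ Finset.Icc 2 s, (q : ℚ) ^ (u j - r) = (q : ℚ) ^ i * B + R := by
    exact_mod_cast hsplit
  have hpow' : (t : ℚ) * (q : ℚ) ^ (k - r) = (q : ℚ) ^ i * ((t * q ^ (k - r - i) : ℕ) : ℚ) := by
    exact_mod_cast hpow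
  have hlt' : (R : ℚ) < (q : ℚ) ^ i := by exact_mod_cast hlt
  have hpos : (0 : ℚ) < (q : ℚ) ^ i := by positivity
  rw [hsplit', hpow', Int.ceil_eq_iff]
  rw [lt_div_iff₀ hpos, div_le_iff₀ hpos]
  simp only [Int.cast_sub, Int.cast_natCast]
  constructor <;> nlinarith

theorem IsFlagType.sum_ceil_div_pow (hu : IsFlagType k s u) {q : ℕ} (hq : 1 < q) {r : ℕ}
    (hr : r ≤ u 2) {ε : ℚ} (h0 : 0 ≤ ε) (h1 : ε < 1) (hε : ε = 0 ∨ r = u 2) :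
    ∑ i ∈ Finset.Icc 1 (k - r),
      ⌈((t : ℚ) * (q : ℚ) ^ (k - r) - ∑ j ∈ Finset.Icc 2 s, (q : ℚ) ^ (u j - r) + ε) /
        (q : ℚ) ^ i⌉ =
      ((t * numPoints q (k - r) : ℕ) : ℤ) -
        ((∑ j ∈ Finset.Icc 2 s, numPoints q (u j - r) : ℕ) : ℤ) := by
  rw [Finset.sum_congr rfl fun i hi => hu.ceil_div_pow hq hr h0 h1 hε (Finset.mem_Icc.mp hi).1
    (Finset.mem_Icc.mp hi).2, Finset.sum_sub_distrib, ← Nat.cast_sum, ← Nat.cast_sum,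
    Finset.sum_comm, ← Finset.mul_sum]
  congr 2
  · rw [← sum_ite_pow_sub q le_rfl]
    congr 1
    refine Finset.sum_congr rfl fun i hi => ?_
    rw [if_pos (Finset.mem_Icc.mp hi).2]
  · refine Finset.sum_congr rfl fun j hj => sum_ite_pow_sub q ?_
    have := hu.le_last (i := j) (by have := Finset.mem_Icc.mp hj; omega)
    omega

end Ceilings

/-! ### Griesmer defects -/

section Defect

variable {F : Type*} [Field F] [Fintype F] {k s t n : ℕ} {u : ℕ → ℕ}

/-- The ceilings sum to `t[k-r] - ∑ [u_i-r]`, whereas `n - d_r` is this number plus 1, less the 1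
that enters `d_r` once `r` reaches `u 2`. -/
theorem griesmerDefect_eq (hu : IsFlagType k s u)
    (hn : n + ∑ i ∈ Finset.Icc 2 s, numPoints (Fintype.card F) (u i) =
      t * numPoints (Fintype.card F) k + 1)
    {φ : (Fin k → F) →ₗ[F] (Fin n → F)} (hφ : SupportFormula (Fintype.card F) k s t u φ)
    (hinj : Function.Injective φ) {r : ℕ} (hr1 : 1 ≤ r) (hr : r ≤ u 2) :
    griesmerDefect (LinearMap.range φ) r = if r < u 2 then 1 else 0 := by
  have hq : 1 < Fintype.card F := Fintype.one_lt_card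
  have hq' : (1 : ℚ) < (Fintype.card F : ℚ) := by exact_mod_cast hq
  have h2k := hu.lt_last hu.two_le
  have h22 := hu.two_le_of (i := 2) le_rfl (by have := hu.two_le; omega)
  have hG := genHammingWeight_add hu hφ hinj hr1 (by omega)
  have hfr : Module.finrank F (LinearMap.range φ) = k := by
    rw [LinearMap.finrank_range_of_inj hinj]
    simp
  rw [griesmerDefect, hfr]
  set G := genHammingWeight (LinearMap.range φ) r
  set q := Fintype.card F
  set c : ℕ := if r < u 2 then 0 else 1 with hc
  have hrpos : (q : ℚ) - 1 ≤ (q : ℚ) ^ r - 1 := by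
    have : (q : ℚ) ^ 1 ≤ (q : ℚ) ^ r := pow_le_pow_right₀ hq'.le hr1
    linarith [pow_one (q : ℚ)]
  -- The extra 1 in `d_r` at `r = u 2`, rescaled by `(q - 1)/(q^r - 1)`; it is below 1 because `u 2
  -- ≥ 2`.
  set ε : ℚ := c * (((q : ℚ) - 1) / ((q : ℚ) ^ r - 1)) with hεdef
  have hε : 0 ≤ ε ∧ ε < 1 ∧ (ε = 0 ∨ r = u 2) := by
    rw [hεdef, hc]
    split_ifs with h
    · simp
    · have hr2 : r = u 2 := by omega
      refine ⟨?_, ?_, .inr hr2⟩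
      · rw [Nat.cast_one, one_mul]
        exact div_nonneg (by linarith) (by linarith)
      · rw [Nat.cast_one, one_mul, div_lt_one (by linarith)]
        have : (q : ℚ) ^ 1 < (q : ℚ) ^ r := pow_lt_pow_right₀ hq' (by omega)
        linarith [pow_one (q : ℚ)]
  have hmul : ((q : ℚ) - 1) * G = ((q : ℚ) ^ r - 1) *
      ((t : ℚ) * (q : ℚ) ^ (k - r) - ∑ j ∈ Finset.Icc 2 s, (q : ℚ) ^ (u j - r) + ε) := by
    have h1 := congrArg (Nat.cast (R := ℚ)) hG
    push_cast at h1
    have hm : ∀ m, ((q : ℚ) - 1) * numPoints q m = (q : ℚ) ^ m - 1 := by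
      intro m
      rw [cast_numPoints hq, mul_div_cancel₀ _ (by linarith)]
    have hm2 : ∀ m, r ≤ m → ((q : ℚ) - 1) * (numPoints q m - numPoints q (m - r)) =
        ((q : ℚ) ^ r - 1) * (q : ℚ) ^ (m - r) := by
      intro m hmr
      rw [mul_sub, hm, hm, sub_mul, ← pow_add, Nat.add_sub_cancel' hmr]
      ring
    have hs : ((q : ℚ) - 1) * ((∑ i ∈ Finset.Icc 2 s, (numPoints q (u i) : ℚ)) -
        ∑ i ∈ Finset.Icc 2 s, (numPoints q (u i - r) : ℚ)) =
        ((q : ℚ) ^ r - 1) * ∑ j ∈ Finset.Icc 2 s, (q : ℚ) ^ (u j - r) := by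
      rw [← Finset.sum_sub_distrib, Finset.mul_sum, Finset.mul_sum]
      refine Finset.sum_congr rfl fun i hi => hm2 _ ?_
      rw [Finset.mem_Icc] at hi
      exact hr.trans (hu.le hi.1 (by omega))
    have hk := hm2 k (by omega)
    have hce : ((q : ℚ) ^ r - 1) * ε = c * ((q : ℚ) - 1) := by
      rw [hεdef]
      have : (q : ℚ) ^ r - 1 ≠ 0 := by
        have : 0 < (q : ℚ) ^ r - 1 := by linarith
        exact this.ne'
      field_simp
    linear_combination ((q : ℚ) - 1) * h1 + t * hk - hs - hce
  have hterm : ∀ i, ((q : ℚ) - 1) * G / ((q : ℚ) ^ i * ((q : ℚ) ^ r - 1)) =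
      ((t : ℚ) * (q : ℚ) ^ (k - r) - ∑ j ∈ Finset.Icc 2 s, (q : ℚ) ^ (u j - r) + ε) /
        (q : ℚ) ^ i := by
    intro i
    rw [hmul, mul_comm ((q : ℚ) ^ i), mul_div_mul_left]
    linarith
  simp only [hterm]
  rw [hu.sum_ceil_div_pow hq hr hε.1 hε.2.1 hε.2.2]
  split_ifs at hc ⊢ <;> omega

end Defect

/-! ### The Griesmer bound by residual codes -/

section Griesmer

variable {F : Type*} [Field F] [Fintype F] [DecidableEq F]

/-- Coordinatewise: where `c` vanishes, all `q` words agree with `x`; elsewhere exactly one scalar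
`α` produces a zero. -/
theorem sum_hammingNorm_sub_smul {ι : Type*} [Fintype ι] (c x : ι → F) :
    ∑ α : F, hammingNorm (x - α • c) =
      Fintype.card F * hammingNorm (fun i : {i // c i = 0} => x i) +
        (Fintype.card F - 1) * hammingNorm c := by
  have hnorm : ∀ y : ι → F, hammingNorm y = ∑ i, if y i ≠ 0 then 1 else 0 := fun y => by
    rw [hammingNorm, Finset.card_filter]
  have hres : hammingNorm (fun i : {i // c i = 0} => x i) =
      ∑ i, if c i = 0 then (if x i ≠ 0 then 1 else 0) else 0 := by
    rw [hammingNorm, Finset.card_filter, ← Finset.sum_filter (fun i => c i = 0)]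
    exact (Finset.sum_subtype (p := fun i => c i = 0) {i | c i = 0}
      (fun i => by rw [Finset.mem_filter, and_iff_right (Finset.mem_univ i)])
      (fun i => if x i ≠ 0 then 1 else 0)).symm
  simp only [hnorm] at hres ⊢
  rw [hres, Finset.sum_comm, Finset.mul_sum, Finset.mul_sum, ← Finset.sum_add_distrib]
  refine Finset.sum_congr rfl fun i _ => ?_
  by_cases hc : c i = 0
  · simp [hc]
  · have : ∀ α : F, (x - α • c) i ≠ 0 ↔ α ≠ x i / c i := by
      intro α
      rw [Pi.sub_apply, Pi.smul_apply, smul_eq_mul, sub_ne_zero, ne_eq, ne_eq, eq_div_iff hc,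
        eq_comm]
    simp only [this]
    rw [← Finset.card_filter, Finset.filter_ne', Finset.card_erase_of_mem (Finset.mem_univ _)]
    simp [hc]

/-- The Griesmer bound. -/
theorem griesmer_bound (K : ℕ) : ∀ {ι : Type} [Fintype ι] (C : Submodule F (ι → F)) (d : ℕ),
    K ≤ Module.finrank F C → (∀ x ∈ C, x ≠ 0 → d ≤ hammingNorm x) →
    ∑ i ∈ Finset.range K, ⌈(d : ℚ) / (Fintype.card F : ℚ) ^ i⌉₊ ≤ Fintype.card ι := by
  induction K with
  | zero => intros; simp
  | succ K ih =>
    intro ι _ C d hK hd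
    have hq : 1 < Fintype.card F := Fintype.one_lt_card
    have hne : ∃ x, x ∈ C ∧ x ≠ 0 := by
      have : C ≠ ⊥ := by
        rintro rfl
        rw [finrank_bot] at hK
        omega
      exact (Submodule.ne_bot_iff C).mp this
    obtain ⟨c, ⟨hcC, hc0⟩, hmin⟩ := exists_minimalFor_of_wellFoundedLT
      (fun x : ι → F => x ∈ C ∧ x ≠ 0) hammingNorm hne
    have hmin' : ∀ x ∈ C, x ≠ 0 → hammingNorm c ≤ hammingNorm x := by
      intro x hx hx0
      rcases le_total (hammingNorm c) (hammingNorm x) with h | h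
      · exact h
      · exact hmin ⟨hx, hx0⟩ h
    -- The residual code: restriction to the zeros of a minimum-weight word `c`.
    let π : (ι → F) →ₗ[F] ({i // c i = 0} → F) := LinearMap.funLeft F F Subtype.val
    -- All `q` words `x - α c` have weight at least that of `c`; summing gives `q w(c) ≤ q w(π x) +
    -- (q - 1) w(c)`.
    have hπ : ∀ x ∈ C, x ∉ Submodule.span F {c} →
        hammingNorm c ≤ Fintype.card F * hammingNorm (π x) := by
      intro x hx hxc
      have h1 : Fintype.card F * hammingNorm c ≤ ∑ α : F, hammingNorm (x - α • c) := by
        rw [← smul_eq_mul, ← Finset.card_univ, ← Finset.sum_const]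
        refine Finset.sum_le_sum fun α _ => hmin' _ (C.sub_mem hx (C.smul_mem _ hcC)) ?_
        intro h
        rw [sub_eq_zero] at h
        exact hxc (Submodule.mem_span_singleton.mpr ⟨α, h.symm⟩)
      rw [sum_hammingNorm_sub_smul] at h1
      have h2 : Fintype.card F * hammingNorm c =
          hammingNorm c + (Fintype.card F - 1) * hammingNorm c := by
        obtain ⟨p, hp⟩ := Nat.exists_eq_add_of_lt hq
        rw [hp, show 1 + p + 1 - 1 = p + 1 by omega]
        ring
      have h3 : hammingNorm (π x) = hammingNorm (fun i : {i // c i = 0} => x i) := rfl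
      rw [← h3] at h1
      omega
    have hker : ∀ x ∈ C, π x = 0 → x ∈ Submodule.span F {c} := by
      intro x hx h0
      by_contra hxc
      have h1 := hπ x hx hxc
      rw [h0, hammingNorm_zero, mul_zero] at h1
      exact hc0 (hammingNorm_eq_zero.mp (by omega))
    have hfr : K ≤ Module.finrank F (C.map π) := by
      have h1 := LinearMap.finrank_range_add_finrank_ker (π.domRestrict C)
      rw [LinearMap.range_domRestrict] at h1
      have h2 : Module.finrank F (LinearMap.ker (π.domRestrict C)) ≤ 1 := by
        rw [← Submodule.finrank_map_subtype_eq, ← finrank_span_singleton (K := F) hc0]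
        apply Submodule.finrank_mono
        rintro _ ⟨x, hx, rfl⟩
        exact hker x x.2 hx
      omega
    have hres := ih (C.map π) ⌈(hammingNorm c : ℚ) / Fintype.card F⌉₊ hfr (by
      rintro _ ⟨x, hx, rfl⟩ hx0
      have hxc : x ∉ Submodule.span F {c} := by
        intro h
        obtain ⟨α, rfl⟩ := Submodule.mem_span_singleton.mp h
        apply hx0
        ext i
        show α * c i = 0
        rw [i.2, mul_zero]
      rw [Nat.ceil_le, div_le_iff₀ (by positivity), mul_comm]
      exact_mod_cast hπ x hx hxc)
    have hcard : Fintype.card {i // c i = 0} + hammingNorm c = Fintype.card ι := by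
      rw [hammingNorm, ← Fintype.card_subtype, Fintype.card_subtype_compl]
      have := Fintype.card_subtype_le fun i => c i = 0
      omega
    -- The term `i = 0` is bounded by the weight of `c`; the shifted terms are bounded by the
    -- Griesmer sum of the residual code.
    rw [Finset.sum_range_succ', ← hcard]
    refine add_le_add (le_trans (Finset.sum_le_sum fun i _ => ?_) hres) ?_
    · apply Nat.ceil_mono
      rw [pow_succ', ← div_div]
      refine div_le_div_of_nonneg_right ?_ (by positivity)
      refine le_trans ?_ (Nat.le_ceil _)
      refine div_le_div_of_nonneg_right ?_ (by positivity)
      exact_mod_cast hd c hcC hc0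
    · simpa using hd c hcC hc0

end Griesmer

/-! ### Distance-optimality -/

section Optimal

variable {F : Type*} [Field F] [Fintype F] [DecidableEq F] {k s t n : ℕ} {u : ℕ → ℕ}

/-- The Griesmer sum for `d` is `n - 1`. Passing to `d + 1` raises the term `i = 0` by 1 and, since
`q` divides `d`, also the term `i = 1`, so the new sum is at least `n + 1`. -/
theorem length_lt_sum_ceil (hu : IsFlagType k s u) (hst : s ≤ t + 1) {q : ℕ} (hq : 1 < q)
    (hn : n + ∑ i ∈ Finset.Icc 2 s, numPoints q (u i) = t * numPoints q k + 1) :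
    n < ∑ i ∈ Finset.range k, ⌈((flagDist q k s t u + 1 : ℕ) : ℚ) / (q : ℚ) ^ i⌉₊ := by
  have hk := hu.three_le
  have h22 := hu.two_le_of (i := 2) le_rfl (by have := hu.two_le; omega)
  have hd := flagDist_add hu hst hq
  set d := flagDist q k s t u
  have hd' : (d : ℚ) = (t : ℚ) * (q : ℚ) ^ (k - 1) -
      ∑ j ∈ Finset.Icc 2 s, (q : ℚ) ^ (u j - 1) + 0 := by
    have := congrArg (Nat.cast (R := ℚ)) hd
    push_cast at this
    linarith
  have hceil := hu.sum_ceil_div_pow (t := t) hq (r := 1) (by omega) le_rfl one_pos (.inl rfl)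
  have hone := hu.ceil_div_pow (t := t) hq (r := 1) (by omega) le_rfl one_pos (.inl rfl)
    (i := 1) le_rfl (by omega)
  rw [← hd'] at hceil hone
  have hdvd : (d : ℤ) = q * ⌈(d : ℚ) / (q : ℚ) ^ 1⌉ := by
    rw [hone]
    have h1 : t * q ^ (k - 1) = q * (t * q ^ (k - 1 - 1)) := by
      rw [mul_left_comm, ← pow_succ']
      congr 2
      omega
    have h2 : ∑ j ∈ Finset.Icc 2 s, q ^ (u j - 1) = q * ∑ j ∈ Finset.Icc 2 s,
        (if 1 ≤ u j - 1 then q ^ (u j - 1 - 1) else 0) := by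
      rw [Finset.mul_sum]
      refine Finset.sum_congr rfl fun j hj => ?_
      rw [Finset.mem_Icc] at hj
      have := hu.two_le_of hj.1 (by omega)
      rw [if_pos (by omega), ← pow_succ']
      congr 1
      omega
    have h3 := hd
    rw [h1, h2] at h3
    rw [mul_sub]
    have := congrArg (Nat.cast (R := ℤ)) h3
    push_cast at this ⊢
    linarith
  have hsum : ∑ i ∈ Finset.range k, (⌈((d + 1 : ℕ) : ℚ) / (q : ℚ) ^ i⌉₊ : ℤ) =
      (d + 1 : ℕ) + ∑ i ∈ Finset.Icc 1 (k - 1), ⌈((d + 1 : ℕ) : ℚ) / (q : ℚ) ^ i⌉ := by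
    obtain ⟨p, rfl⟩ : ∃ p, k = p + 1 := ⟨k - 1, by omega⟩
    rw [Finset.sum_range_succ', add_comm]
    have hc : ∀ i, (⌈((d + 1 : ℕ) : ℚ) / (q : ℚ) ^ i⌉₊ : ℤ) =
        ⌈((d + 1 : ℕ) : ℚ) / (q : ℚ) ^ i⌉ := fun i => Int.natCast_ceil_eq_ceil (by positivity)
    congr 1
    · rw [pow_zero, div_one, Nat.ceil_natCast]
    · rw [Nat.add_sub_cancel, ← Finset.Ico_add_one_right_eq_Icc, Finset.sum_Ico_eq_sum_range]
      simp only [Nat.add_sub_cancel]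
      refine Finset.sum_congr rfl fun i _ => ?_
      rw [hc, add_comm i 1]
  have hlt : ∑ i ∈ Finset.Icc 1 (k - 1), ⌈(d : ℚ) / (q : ℚ) ^ i⌉ <
      ∑ i ∈ Finset.Icc 1 (k - 1), ⌈((d + 1 : ℕ) : ℚ) / (q : ℚ) ^ i⌉ := by
    refine Finset.sum_lt_sum (fun i _ => ?_) ⟨1, by simp; omega, ?_⟩
    · apply Int.ceil_mono
      refine div_le_div_of_nonneg_right ?_ (by positivity)
      push_cast
      linarith
    · rw [Int.lt_ceil, lt_div_iff₀ (by positivity), pow_one]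
      have := congrArg (Int.cast (R := ℚ)) hdvd
      push_cast at this ⊢
      rw [pow_one] at this
      linarith
  have hpk : t * numPoints q k = t * numPoints q (k - 1) + t * q ^ (k - 1) := by
    rw [← mul_add, ← numPoints_succ]
    congr 2
    omega
  have hpu : ∑ i ∈ Finset.Icc 2 s, numPoints q (u i) =
      ∑ i ∈ Finset.Icc 2 s, numPoints q (u i - 1) + ∑ i ∈ Finset.Icc 2 s, q ^ (u i - 1) := by
    rw [← Finset.sum_add_distrib]
    refine Finset.sum_congr rfl fun i hi => ?_
    rw [Finset.mem_Icc] at hi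
    have := hu.two_le_of hi.1 (by omega)
    rw [← numPoints_succ]
    congr 1
    omega
  have hfin : ((∑ i ∈ Finset.range k, ⌈((d + 1 : ℕ) : ℚ) / (q : ℚ) ^ i⌉₊ : ℕ) : ℤ) =
      ∑ i ∈ Finset.range k, (⌈((d + 1 : ℕ) : ℚ) / (q : ℚ) ^ i⌉₊ : ℤ) := Nat.cast_sum _ _
  omega

theorem isDistanceOptimal_range (hu : IsFlagType k s u) (hst : s ≤ t + 1)
    (hn : n + ∑ i ∈ Finset.Icc 2 s, numPoints (Fintype.card F) (u i) =
      t * numPoints (Fintype.card F) k + 1)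
    {φ : (Fin k → F) →ₗ[F] (Fin n → F)} (hφ : SupportFormula (Fintype.card F) k s t u φ) :
    IsDistanceOptimal (LinearMap.range φ) := by
  rintro ⟨C', hfr, hlt⟩
  rw [minDist_eq_flagDist hu hst hφ] at hlt
  rw [LinearMap.finrank_range_of_inj (injective_of_supportFormula hu hst hφ),
    Module.finrank_fintype_fun_eq_card, Fintype.card_fin] at hfr
  have h := griesmer_bound k C' (flagDist (Fintype.card F) k s t u + 1) hfr.ge (by
    intro x hx hx0
    refine le_trans hlt (Nat.sInf_le ⟨x, hx, 0, C'.zero_mem, hx0, hammingDist_zero_right x⟩))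
  rw [Fintype.card_fin] at h
  exact absurd (length_lt_sum_ceil hu hst Fintype.one_lt_card hn) (by omega)

end Optimal

/-! ### Subcode support weight distributions -/

section Subcodes

variable {F : Type*} [Field F] {k s t n : ℕ} {u : ℕ → ℕ}

/-- `V ↦ φ(V^⊥)` is a bijection from subspaces of dimension `k - r` onto subcodes of dimension `r`.
-/
theorem subcodeCount_range {φ : (Fin k → F) →ₗ[F] (Fin n → F)} (hφ : Function.Injective φ)
    {r : ℕ} (hr : r ≤ k) (j : ℕ) :
    subcodeCount (LinearMap.range φ) r j =
      {V : Submodule F (Fin k → F) | Module.finrank F V = k - r ∧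
        suppWeight ((dotPerp V).map φ) = j}.ncard := by
  have hinj : Function.Injective fun V : Submodule F (Fin k → F) => (dotPerp V).map φ := by
    intro V W h
    have h1 : dotPerp V = dotPerp W := Submodule.map_injective_of_injective hφ h
    rw [← dotPerp_dotPerp V, h1, dotPerp_dotPerp]
  have hfr : ∀ A : Submodule F (Fin k → F), Module.finrank F (A.map φ) = Module.finrank F A :=
    fun A => (Submodule.equivMapOfInjective φ hφ A).finrank_eq.symm
  rw [subcodeCount, ← Set.ncard_image_of_injective _ hinj]
  congr 1
  ext U
  constructor
  · rintro ⟨hU, hUr, hw⟩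
    have hmap : (U.comap φ).map φ = U := Submodule.map_comap_eq_of_le hU
    refine ⟨dotPerp (U.comap φ), ⟨?_, ?_⟩, ?_⟩
    · rw [finrank_dotPerp, ← hfr, hmap, hUr]
    · rw [dotPerp_dotPerp, hmap, hw]
    · simp only [dotPerp_dotPerp, hmap]
  · rintro ⟨V, ⟨hV, hw⟩, rfl⟩
    refine ⟨LinearMap.map_le_range, ?_, hw⟩
    rw [hfr, finrank_dotPerp, hV]
    omega

/-- The dimensions of the intersections of `V` with the coordinate flag. -/
def flagProfile (s : ℕ) (u : ℕ → ℕ) (V : Submodule F (Fin k → F)) : Fin (s + 2) → ℕ :=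
  fun i => Module.finrank F (coordSpan F k (u i) ⊓ V : Submodule F (Fin k → F))

theorem entry_eq {v : Fin (s + 2) → ℕ} {i : ℕ} (hi : i < s + 2) : entry v i = v ⟨i, hi⟩ := by
  rw [entry]
  congr 1
  exact Fin.ext (Nat.mod_eq_of_lt hi)

theorem entry_flagProfile {i : ℕ} (hi : i < s + 2) (V : Submodule F (Fin k → F)) :
    entry (flagProfile s u V) i =
      Module.finrank F (coordSpan F k (u i) ⊓ V : Submodule F (Fin k → F)) := by
  rw [entry_eq hi]
  rfl

theorem flagProfile_eq_iff {V : Submodule F (Fin k → F)} {v : Fin (s + 2) → ℕ} :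
    flagProfile s u V = v ↔ ∀ i ≤ s + 1,
      Module.finrank F (coordSpan F k (u i) ⊓ V : Submodule F (Fin k → F)) = entry v i := by
  constructor
  · rintro rfl i hi
    rw [entry_flagProfile (by omega)]
  · intro h
    ext ⟨i, hi⟩
    rw [← entry_eq (v := v) hi, ← h i (by omega)]
    rfl

theorem finrank_coordSpan_inf_le (V : Submodule F (Fin k → F)) {m m' : ℕ} (h : m ≤ m')
    (hm' : m' ≤ k) :
    Module.finrank F (coordSpan F k m' ⊓ V : Submodule F (Fin k → F)) ≤
      Module.finrank F (coordSpan F k m ⊓ V : Submodule F (Fin k → F)) + (m' - m) := by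
  have h1 := Submodule.finrank_sup_add_finrank_inf_eq (coordSpan F k m)
    (coordSpan F k m' ⊓ V)
  rw [← inf_assoc, inf_eq_left.mpr (coordSpan_mono h), finrank_coordSpan (h.trans hm')] at h1
  have h2 : Module.finrank F (coordSpan F k m ⊔ coordSpan F k m' ⊓ V :
      Submodule F (Fin k → F)) ≤ Module.finrank F (coordSpan F k m') :=
    Submodule.finrank_mono (sup_le (coordSpan_mono h) inf_le_left)
  rw [finrank_coordSpan hm'] at h2
  omega

/-- Identifies the rational equation defining `Z` with the support formula at a subspace of profile
`v`. -/
theorem weight_equation_iff {q : ℕ} (hq : 1 < q) {r : ℕ} (j : ℕ) (v : ℕ → ℕ) :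
    ((j : ℚ) - t * (((q : ℚ) ^ k - (q : ℚ) ^ (k - r)) / ((q : ℚ) - 1)) +
        (∑ i ∈ Finset.Icc 2 s, ((q : ℚ) ^ u i - 1) / ((q : ℚ) - 1)) - 1 =
      (∑ i ∈ Finset.Icc 2 s, ((q : ℚ) ^ v i - 1) / ((q : ℚ) - 1)) -
        ((q : ℚ) ^ v 1 - 1) / ((q : ℚ) - 1)) ↔
    j + t * numPoints q (k - r) + numPoints q (v 1) + ∑ i ∈ Finset.Icc 2 s, numPoints q (u i) =
      t * numPoints q k + 1 + ∑ i ∈ Finset.Icc 2 s, numPoints q (v i) := by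
  have h1 : ((q : ℚ) ^ k - (q : ℚ) ^ (k - r)) / ((q : ℚ) - 1) =
      numPoints q k - numPoints q (k - r) := by
    rw [cast_numPoints hq, cast_numPoints hq]
    ring
  rw [h1]
  simp only [← cast_numPoints hq]
  rw [← Nat.cast_inj (R := ℚ)]
  push_cast
  constructor <;> intro h <;> linarith

theorem subcodeCount_eq_sum [Fintype F] (hu : IsFlagType k s u)
    {φ : (Fin k → F) →ₗ[F] (Fin n → F)} (hφ : SupportFormula (Fintype.card F) k s t u φ)
    (hinj : Function.Injective φ) {r : ℕ} (hr : r ≤ k) (j : ℕ) :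
    (subcodeCount (LinearMap.range φ) r j : ℚ) =
      ∑ v ∈ tuples (Fintype.card F) k r s u
          ((j : ℚ) - t * (((Fintype.card F : ℚ) ^ k - (Fintype.card F : ℚ) ^ (k - r)) /
            ((Fintype.card F : ℚ) - 1)) +
            (∑ i ∈ Finset.Icc 2 s,
              ((Fintype.card F : ℚ) ^ u i - 1) / ((Fintype.card F : ℚ) - 1)) - 1),
        flagCount (Fintype.card F) s u v := by
  classical
  have hq : 1 < Fintype.card F := Fintype.one_lt_card
  have hs := hu.two_le
  set q := Fintype.card F
  have hweight : ∀ V : Submodule F (Fin k → F), Module.finrank F V = k - r →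
      suppWeight ((dotPerp V).map φ) + t * numPoints q (k - r) +
        numPoints q (Module.finrank F (coordSpan F k (u 1) ⊓ V : Submodule F _)) +
        ∑ i ∈ Finset.Icc 2 s, numPoints q (u i) =
      t * numPoints q k + 1 + ∑ i ∈ Finset.Icc 2 s,
        numPoints q (Module.finrank F (coordSpan F k (u i) ⊓ V : Submodule F _)) := by
    intro V hV
    have h := hφ (dotPerp V)
    rw [dotPerp_dotPerp, finrank_dotPerp, hV, show k - (k - (k - r)) = k - r by omega] at h
    exact h
  rw [subcodeCount_range hinj hr, ncard_eq_sum_ncard_fiber _ (flagProfile s u)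
    (tuples q k r s u ((j : ℚ) - t * (((q : ℚ) ^ k - (q : ℚ) ^ (k - r)) / ((q : ℚ) - 1)) +
            (∑ i ∈ Finset.Icc 2 s, ((q : ℚ) ^ u i - 1) / ((q : ℚ) - 1)) - 1)) ?_, Nat.cast_sum]
  · refine Finset.sum_congr rfl fun v hv => ?_
    rw [tuples, Finset.mem_filter] at hv
    obtain ⟨hv0, hvk, hvi, hvm⟩ := hv.2
    rw [weight_equation_iff hq] at hvm
    -- `ncard_flag` needs a monotone family on all of `ℕ`, while `u` is controlled only up to `s +
    -- 1`; the flag is continued as a constant.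
    let U : ℕ → Submodule F (Fin k → F) := fun i => coordSpan F k (u (min i (s + 1)))
    have hU : ∀ i ≤ s + 1, U i = coordSpan F k (u i) := fun i hi => by
      simp only [U, min_eq_left hi]
    have hUf : ∀ i ≤ s + 1, Module.finrank F (U i) = u i := fun i hi => by
      rw [hU i hi, finrank_coordSpan (hu.le_last hi)]
    have hset : {V | V ∈ {V : Submodule F (Fin k → F) | Module.finrank F V = k - r ∧
          suppWeight ((dotPerp V).map φ) = j} ∧ flagProfile s u V = v} =
        {V : Submodule F (Fin k → F) | V ≤ U (s + 1) ∧
          ∀ i ≤ s + 1, Module.finrank F (U i ⊓ V : Submodule F (Fin k → F)) = entry v i} := by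
      ext V
      simp only [Set.mem_ofPred_eq, flagProfile_eq_iff]
      constructor
      · rintro ⟨-, h⟩
        refine ⟨by rw [hU _ le_rfl, hu.last, coordSpan_self]; exact le_top, fun i hi => ?_⟩
        rw [hU i hi, h i hi]
      · rintro ⟨-, h⟩
        have h' : ∀ i ≤ s + 1,
            Module.finrank F (coordSpan F k (u i) ⊓ V : Submodule F (Fin k → F)) = entry v i := by
          intro i hi
          rw [← hU i hi, h i hi]
        have hVr : Module.finrank F V = k - r := by
          have := h' (s + 1) le_rfl
          rw [hu.last, coordSpan_self, top_inf_eq] at this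
          omega
        refine ⟨⟨hVr, ?_⟩, h'⟩
        have hw := hweight V hVr
        have hsum : ∑ i ∈ Finset.Icc 2 s, numPoints q
            (Module.finrank F (coordSpan F k (u i) ⊓ V : Submodule F (Fin k → F))) =
            ∑ i ∈ Finset.Icc 2 s, numPoints q (entry v i) := by
          refine Finset.sum_congr rfl fun i hi => ?_
          rw [Finset.mem_Icc] at hi
          rw [h' i (by omega)]
        rw [h' 1 (by omega), hsum] at hw
        omega
    have hdiff : ∀ i < s + 1, entry v i ≤ entry v (i + 1) ∧
        entry v (i + 1) - entry v i ≤
          Module.finrank F (U (i + 1)) - Module.finrank F (U i) := by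
      intro i hi
      rw [hUf _ (by omega), hUf _ (by omega)]
      have hlt := hu.lt_succ i (by omega)
      rcases Nat.lt_or_ge i s with his | his
      · have h := hvi (i + 1) (Finset.mem_Icc.mpr ⟨by omega, by omega⟩)
        rw [Nat.add_sub_cancel] at h
        omega
      -- The last step is not among the difference conditions of `Z`; it follows from `u_s - r ≤ v_s
      -- ≤ k - r` and `v_{s+1} = k - r`.
      · have : i = s := by omega
        subst this
        have h := hvi i (Finset.mem_Icc.mpr ⟨by omega, le_rfl⟩)
        have hlast := hu.last
        omega
    have key := ncard_flag U (fun i i' h => coordSpan_mono (hu.le (by omega) (by omega)))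
      (by rw [hU 0 (by omega), hu.zero, coordSpan_zero]) (entry v) hv0 (s + 1) hdiff
    rw [hset, key, flagCount]
    refine Finset.prod_congr rfl fun i hi => ?_
    rw [Finset.mem_Icc] at hi
    rw [hUf i hi.2, hUf (i - 1) (by omega)]
  · rintro V ⟨hV, hw⟩
    have hle : ∀ i, Module.finrank F (coordSpan F k (u i) ⊓ V : Submodule F (Fin k → F)) ≤
        k - r := fun i => hV ▸ Submodule.finrank_mono inf_le_right
    rw [tuples, Finset.mem_filter, Fintype.mem_piFinset]
    refine ⟨fun i => Finset.mem_range.mpr ((hle i).trans_lt (by omega)), ?_, ?_, ?_, ?_⟩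
    · rw [entry_flagProfile (by omega), hu.zero, coordSpan_zero, bot_inf_eq, finrank_bot]
    · rw [entry_flagProfile (by omega), hu.last, coordSpan_self, top_inf_eq, hV]
      omega
    · intro i hi
      rw [Finset.mem_Icc] at hi
      rw [entry_flagProfile (by omega), entry_flagProfile (by omega)]
      have hlt := hu.lt (show i - 1 < i by omega) (by omega)
      have hik := hu.le_last (i := i) (by omega)
      have h1 : Module.finrank F (coordSpan F k (u (i - 1)) ⊓ V : Submodule F (Fin k → F)) ≤
          Module.finrank F (coordSpan F k (u i) ⊓ V : Submodule F (Fin k → F)) :=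
        Submodule.finrank_mono (inf_le_inf_right _ (coordSpan_mono hlt.le))
      have h2 := finrank_coordSpan_inf_le V hlt.le hik
      have h3 : Module.finrank F (coordSpan F k (u i) ⊓ V : Submodule F (Fin k → F)) ≤ u i := by
        exact (Submodule.finrank_mono inf_le_left).trans (finrank_coordSpan hik).le
      have h4 := le_finrank_coordSpan_inf_dotPerp hik (dotPerp V)
      rw [dotPerp_dotPerp, finrank_dotPerp, hV] at h4
      have h5 := hle i
      omega
    · rw [weight_equation_iff hq, entry_flagProfile (by omega)]
      have h := hweight V hV
      rw [hw] at h
      rw [h]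
      congr 1
      refine Finset.sum_congr rfl fun i hi => ?_
      rw [Finset.mem_Icc] at hi
      rw [entry_flagProfile (by omega)]

end Subcodes

end SubcodeSupport

end

/-! ### Assembly of the theorem -/

theorem mainTheorem2 {F : Type*} [Field F] [Fintype F] [DecidableEq F]
    (q k s t : ℕ) (hq : Fintype.card F = q) (hs : 2 ≤ s) (hst : s ≤ t + 1)
    (u : ℕ → ℕ) (hu0 : u 0 = 0) (hu1 : u 1 = 1) (huk : u (s + 1) = k)
    (hu : ∀ i ≤ s, u i < u (i + 1)) :
    (∃ S : Matrix (Fin k) (Fin ((q ^ k - 1) / (q - 1))) F,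
      SubcodeSupport.PairwiseIndepCols S) ∧
    ∀ S : Matrix (Fin k) (Fin ((q ^ k - 1) / (q - 1))) F,
      SubcodeSupport.PairwiseIndepCols S →
    -- `e` fixes an order of the columns
    ∀ (n : ℕ) (e : Fin n ≃ SubcodeSupport.ColIdx S s t u)
      (C : Submodule F (Fin n → F)),
      C = SubcodeSupport.codeOf ((SubcodeSupport.blockMatrix S s t u).submatrix id e) →
    -- length, dimension, minimum distance
    ((n : ℚ) = t * (((q : ℚ) ^ k - 1) / ((q : ℚ) - 1)) -
        (∑ i ∈ Finset.Icc 2 s, ((q : ℚ) ^ u i - 1) / ((q : ℚ) - 1)) + 1) ∧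
    Module.finrank F C = k ∧
    ((SubcodeSupport.minDist C : ℚ) = t * (q : ℚ) ^ (k - 1) -
        ∑ i ∈ Finset.Icc 2 s, (q : ℚ) ^ (u i - 1)) ∧
    -- weight distribution
    (SubcodeSupport.weightCount C 0 = 1 ∧
      ((SubcodeSupport.weightCount C (SubcodeSupport.minDist C) : ℚ) =
        (q : ℚ) ^ (k - 1) - (q : ℚ) ^ (k - u 2)) ∧
      ((SubcodeSupport.weightCount C (SubcodeSupport.minDist C + 1) : ℚ) =
        (q : ℚ) ^ k - (q : ℚ) ^ (k - 1)) ∧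
      (∀ l, 2 ≤ l → l < s →
        (SubcodeSupport.weightCount C
            (SubcodeSupport.minDist C + ∑ i ∈ Finset.Icc 2 l, q ^ (u i - 1)) : ℚ) =
          (q : ℚ) ^ (k - u l) - (q : ℚ) ^ (k - u (l + 1))) ∧
      ((SubcodeSupport.weightCount C
          (SubcodeSupport.minDist C + ∑ i ∈ Finset.Icc 2 s, q ^ (u i - 1)) : ℚ) =
        (q : ℚ) ^ (k - u s) - 1) ∧
      (∀ j, j ≠ 0 → j ≠ SubcodeSupport.minDist C → j ≠ SubcodeSupport.minDist C + 1 →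
        (∀ l, 2 ≤ l → l ≤ s →
          j ≠ SubcodeSupport.minDist C + ∑ i ∈ Finset.Icc 2 l, q ^ (u i - 1)) →
        SubcodeSupport.weightCount C j = 0)) ∧
    -- generalized Hamming weights
    ((∀ r, 1 ≤ r → r < u 2 →
        (SubcodeSupport.genHammingWeight C r : ℚ) =
          t * (((q : ℚ) ^ k - (q : ℚ) ^ (k - r)) / ((q : ℚ) - 1)) -
            ∑ i ∈ Finset.Icc 2 s, ((q : ℚ) ^ u i - (q : ℚ) ^ (u i - r)) / ((q : ℚ) - 1)) ∧
      (∀ r jr, u 2 ≤ r → r ≤ k → IsGreatest {j | 2 ≤ j ∧ j ≤ s ∧ u j ≤ r} jr →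
        (SubcodeSupport.genHammingWeight C r : ℚ) =
          t * (((q : ℚ) ^ k - (q : ℚ) ^ (k - r)) / ((q : ℚ) - 1)) -
            (∑ i ∈ Finset.Icc 2 s, ((q : ℚ) ^ u i - 1) / ((q : ℚ) - 1)) +
            (∑ i ∈ Finset.Icc (jr + 1) s, ((q : ℚ) ^ (u i - r) - 1) / ((q : ℚ) - 1)) + 1)) ∧
    -- Griesmer properties and optimality
    (SubcodeSupport.IsRGriesmer C (u 2) ∧ SubcodeSupport.IsAlmostGriesmer C ∧
      SubcodeSupport.IsDistanceOptimal C) ∧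
    -- subcode support weight distributions
    (∀ r j, 1 ≤ r → r ≤ k → 1 ≤ j → j ≤ n →
      (SubcodeSupport.subcodeCount C r j : ℚ) =
        ∑ v ∈ SubcodeSupport.tuples q k r s u
            ((j : ℚ) - t * (((q : ℚ) ^ k - (q : ℚ) ^ (k - r)) / ((q : ℚ) - 1)) +
              (∑ i ∈ Finset.Icc 2 s, ((q : ℚ) ^ u i - 1) / ((q : ℚ) - 1)) - 1),
          SubcodeSupport.flagCount q s u v) := by
  subst hq
  have hf : SubcodeSupport.IsFlagType k s u := ⟨hs, hu0, hu1, huk, hu⟩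
  have hq : 1 < Fintype.card F := Fintype.one_lt_card
  have hq' : (1 : ℚ) < (Fintype.card F : ℚ) := by exact_mod_cast hq
  refine ⟨SubcodeSupport.exists_pairwiseIndepCols k, ?_⟩
  rintro S hS n e C rfl
  rw [SubcodeSupport.codeOf_eq_range]
  obtain ⟨hn, hφ⟩ := SubcodeSupport.supportFormula_blockMatrix hf hst hS e
  set φ := ((SubcodeSupport.blockMatrix S s t u).submatrix id e).vecMulLinear
  have hinj := SubcodeSupport.injective_of_supportFormula hf hst hφ
  have hrank : Module.finrank F (LinearMap.range φ) = k := by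
    rw [LinearMap.finrank_range_of_inj hinj, Module.finrank_fintype_fun_eq_card, Fintype.card_fin]
  have hlevel := fun l (hl : l ≤ s) => SubcodeSupport.weightCount_level hf hst hφ hl
  have hdist := SubcodeSupport.flagDist_add (t := t) hf hst hq
  rw [SubcodeSupport.minDist_eq_flagDist hf hst hφ]
  have hlw : ∀ l, 1 ≤ l → SubcodeSupport.levelWeight (Fintype.card F) k s t u l =
      SubcodeSupport.flagDist (Fintype.card F) k s t u +
        ∑ i ∈ Finset.Icc 2 l, Fintype.card F ^ (u i - 1) := fun l hl => by
    rw [SubcodeSupport.levelWeight, if_neg (by omega)]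
  have hlw0 : SubcodeSupport.levelWeight (Fintype.card F) k s t u 0 =
      SubcodeSupport.flagDist (Fintype.card F) k s t u + 1 := by
    rw [SubcodeSupport.levelWeight, if_pos rfl]
  have hlw1 : SubcodeSupport.levelWeight (Fintype.card F) k s t u 1 =
      SubcodeSupport.flagDist (Fintype.card F) k s t u := by
    rw [hlw 1 le_rfl, Finset.Icc_eq_empty (by omega), Finset.sum_empty, add_zero]
  have h2 := hf.two_le_of (i := 2) le_rfl (by omega)
  have h2k := hf.lt_last hs
  have hfrac : ∀ a b : ℕ, ((Fintype.card F : ℚ) ^ a - (Fintype.card F : ℚ) ^ b) /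
      ((Fintype.card F : ℚ) - 1) = SubcodeSupport.numPoints (Fintype.card F) a -
        SubcodeSupport.numPoints (Fintype.card F) b := by
    intro a b
    rw [SubcodeSupport.cast_numPoints hq, SubcodeSupport.cast_numPoints hq]
    ring
  refine ⟨?_, hrank, ?_, ⟨SubcodeSupport.weightCount_zero _, ?_, ?_, ?_, ?_, ?_⟩, ⟨?_, ?_⟩,
    ⟨⟨⟨?_, ?_, ?_⟩, ?_⟩, ?_, SubcodeSupport.isDistanceOptimal_range hf hst hn hφ⟩, ?_⟩
  · have h := congrArg (Nat.cast (R := ℚ)) hn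
    simp only [← SubcodeSupport.cast_numPoints hq]
    push_cast at h
    linarith
  · have h := congrArg (Nat.cast (R := ℚ)) hdist
    push_cast at h
    linarith
  · have h := hlevel 1 (by omega)
    rwa [hlw1, hu1] at h
  · have h := hlevel 0 (by omega)
    rwa [hlw0, zero_add, hu1, hu0, Nat.sub_zero] at h
  · intro l hl hls
    have h := hlevel l hls.le
    rwa [hlw l (by omega)] at h
  · have h := hlevel s le_rfl
    rwa [hlw s (by omega), huk, Nat.sub_self, pow_zero] at h
  · intro j hj0 hj1 hj2 hj
    refine SubcodeSupport.weightCount_eq_zero hf hst hφ hj0 fun l hl => ?_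
    rcases Nat.lt_or_ge l 2 with hl2 | hl2
    · interval_cases l
      · rwa [hlw0]
      · rwa [hlw1]
    · rw [hlw l (by omega)]
      exact hj l hl2 hl
  · intro r hr1 hr
    have h := congrArg (Nat.cast (R := ℚ))
      (SubcodeSupport.genHammingWeight_add hf hφ hinj hr1 (by omega))
    rw [if_pos hr] at h
    simp only [hfrac, Finset.sum_sub_distrib]
    push_cast at h
    linarith
  · intro r jr hr hrk hjr
    have h := congrArg (Nat.cast (R := ℚ))
      (SubcodeSupport.genHammingWeight_add hf hφ hinj (by omega) hrk)
    rw [if_neg (by omega)] at h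
    -- The terms with `i ≤ jr` drop out, since there `u i ≤ u jr ≤ r`.
    have hsum : ∑ i ∈ Finset.Icc 2 s, SubcodeSupport.numPoints (Fintype.card F) (u i - r) =
        ∑ i ∈ Finset.Icc (jr + 1) s, SubcodeSupport.numPoints (Fintype.card F) (u i - r) := by
      symm
      refine Finset.sum_subset (Finset.Icc_subset_Icc_left (by have := hjr.1.1; omega)) ?_
      intro i hi hi'
      rw [Finset.mem_Icc] at hi hi'
      have h3 := hf.le (show i ≤ jr by omega) (by have := hjr.1.2.1; omega)
      have h4 := hjr.1.2.2
      rw [Nat.sub_eq_zero_of_le (by omega), SubcodeSupport.numPoints_zero]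
    rw [hsum] at h
    simp only [← SubcodeSupport.cast_numPoints hq, hfrac]
    push_cast at h
    linarith
  · omega
  · rw [hrank]
    exact h2k.le
  · rw [SubcodeSupport.griesmerDefect_eq hf hn hφ hinj (by omega) le_rfl, if_neg (lt_irrefl _)]
  -- Every index below `u 2` has defect 1, so none of them competes.
  · rintro r ⟨hr1, -, hr⟩
    by_contra hlt
    rw [SubcodeSupport.griesmerDefect_eq hf hn hφ hinj hr1 (by omega), if_pos (by omega)] at hr
    exact one_ne_zero hr
  · rw [SubcodeSupport.IsAlmostGriesmer,
      SubcodeSupport.griesmerDefect_eq hf hn hφ hinj le_rfl (by omega), if_pos (by omega)]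
  · intro r j _ hr _ _
    exact SubcodeSupport.subcodeCount_eq_sum hf hφ hinj hr j
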